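/- Let $G$ be a countably infinite group and let $P=\{P_j\}_{j\ge 0}$ be a sequence of nonempty finite subsets of $G$. For a measure-preserving action $T=\{T_g\}_{g\in G}$ of $G$ on a standard probability space $(X,\mu)$ and a finite measurable partition $\xi$ of $X$ put $$h_j(T,\xi)=\frac1{|P_j|}\,H\Big(\bigvee_{p\in P_j}T_p\xi\Big),\qquad h_P(T,\xi)=\limsup_{j\to\infty}h_j(T,\xi),\qquad h_P(T)=\sup_\xi h_P(T,\xi),$$ where $H(\{C_1,\dots,C_n\})=-\sum_{i}\mu(C_i)\ln\mu(C_i)$ and the supremum is over all finite measurable partitions. A factor of $T$ is the restriction of $T$ to a $T$-invariant sub-$\sigma$-algebra, and its $P$-entropy is the supremum of $h_P(T,\xi)$ over the finite partitions $\xi$ measurable with respect to this $\sigma$-algebra. A factor is nontrivial if its $\sigma$-algebra contains a set of measure different from $0$ and $1$. The action $T$ has completely positive $P$-entropy if every nontrivial factor of $T$ has positive $P$-entropy. Let $T$ and $S$ be measure-preserving actions of $G$ on standard probability spaces $(X,\mu)$ and $(Y,\nu)$. Suppose that $T$ has completely positive $P$-entropy and that $h_P(S)=0$. Then $T$ and $S$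 are disjoint: the only Markov operator $J:L_2(X,\mu)\to L_2(Y,\nu)$ (a bounded linear operator that preserves nonnegativity and satisfies $J1=1$, $J^*1=1$) intertwining $T$ and $S$ is $f\mapsto\int f\,d\mu$. Moreover, an $S$-factor and a $T$-factor are always independent: if $R$ is a measure-preserving action of $G$ on a standard probability space $(Z,\lambda)$, and $\mathcal A$, $\mathcal B$ are $R$-invariant sub-$\sigma$-algebras such that the restriction of $R$ to $\mathcal A$ is isomorphic to $S$ and the restriction of $R$ to $\mathcal B$ is isomorphic to $T$, then $\mathcal A$ and $\mathcal B$ are independent. -/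

import Mathlib

open MeasureTheory Filter

noncomputable section

namespace PEntropy

/-! Throughout, a measure-preserving action of a group `G` on a probability space `(X, μ)` is given
by Mathlib's classes `MulAction G X`, `MeasurableConstSMul G X` and `SMulInvariantMeasure G X μ`;
the transformation `T_g` is `x ↦ g • x`. -/

/-- A finite partition of `X` is encoded by its labelling `ξ : X → ι` with `ι` finite; its cells are
the sets `ξ ⁻¹' {i}` (empty cells contribute `0` to the entropy). This is the Shannon entropy
`H(ξ) = - ∑ i, μ (C_i) * ln (μ (C_i))`. -/
def entropy {X ι : Type*} [MeasurableSpace X] [Fintype ι] (μ : Measure X) (ξ : X → ι) : ℝ :=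
  -∑ i, μ.real (ξ ⁻¹' {i}) * Real.log (μ.real (ξ ⁻¹' {i}))

/-- The partition `T_p ξ = {T_p C_1, …, T_p C_n}`: the point `x` lies in `T_p C_i` iff
`p⁻¹ • x` lies in `C_i`. -/
def translatePartition {G X ι : Type*} [Group G] [MulAction G X] (p : G) (ξ : X → ι) : X → ι :=
  fun x => ξ (p⁻¹ • x)

/-- The join `⋁ p ∈ F, T_p ξ`: two points lie in the same cell iff, for every `p ∈ F`, they
lie in the same cell of `T_p ξ`. -/
def joinTranslates {G X ι : Type*} [Group G] [MulAction G X] (F : Finset G) (ξ : X → ι) : X → (F → ι) :=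
  fun x p => translatePartition (p : G) ξ x

open Classical in
/-- `h_j(T, ξ) = (1 / |F|) * H (⋁ p ∈ F, T_p ξ)` with `F = P_j`. -/
def meanEntropy {G X : Type*} [Group G] [MulAction G X] [MeasurableSpace X] (μ : Measure X)
    (F : Finset G) {n : ℕ} (ξ : X → Fin n) : ℝ :=
  (1 / (F.card : ℝ)) * entropy μ (joinTranslates F ξ)

/-- `h_P(T, ξ) = limsup_j h_j(T, ξ)`. -/
def partitionPEntropy {G X : Type*} [Group G] [MulAction G X] [MeasurableSpace X] (μ : Measure X)
    (P : ℕ → Finset G) {n : ℕ} (ξ : X → Fin n) : EReal :=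
  limsup (fun j => ((meanEntropy μ (P j) ξ : ℝ) : EReal)) atTop

/-- The `P`-entropy of the restriction of the action to the σ-algebra `𝓕`: the supremum of
`h_P(T, ξ)` over all finite `𝓕`-measurable partitions `ξ`. -/
def factorPEntropy {G X : Type*} [Group G] [MulAction G X] (𝓕 : MeasurableSpace X)
    [MeasurableSpace X] (μ : Measure X) (P : ℕ → Finset G) : EReal :=
  ⨆ (n : ℕ) (ξ : X → Fin n) (_ : Measurable[𝓕] ξ), partitionPEntropy μ P ξ

/-- The `P`-entropy `h_P(T)` of the action: the supremum over all finite measurable partitions. -/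
def pEntropy {G X : Type*} [Group G] [MulAction G X] [mX : MeasurableSpace X] (μ : Measure X)
    (P : ℕ → Finset G) : EReal :=
  factorPEntropy mX μ P

/-- A factor of the action: a sub-σ-algebra that is invariant under the action. -/
structure IsFactor (G : Type*) {X : Type*} [Group G] [MulAction G X] (𝓕 : MeasurableSpace X)
    [mX : MeasurableSpace X] : Prop where
  le : 𝓕 ≤ mX
  invariant : ∀ (g : G) (A : Set X), MeasurableSet[𝓕] A → MeasurableSet[𝓕] ((g • ·) ⁻¹' A)

/-- A σ-algebra is nontrivial (modulo `μ`) if it contains a set whose measure is neither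
`0` nor `1`. -/
def IsNontrivialAlgebra {X : Type*} (𝓕 : MeasurableSpace X) [MeasurableSpace X]
    (μ : Measure X) : Prop :=
  ∃ A : Set X, MeasurableSet[𝓕] A ∧ μ A ≠ 0 ∧ μ A ≠ 1

/-- Completely positive `P`-entropy: every nontrivial factor has positive `P`-entropy. -/
def HasCompletelyPositivePEntropy {G X : Type*} [Group G] [MulAction G X] [mX : MeasurableSpace X]
    (μ : Measure X) (P : ℕ → Finset G) : Prop :=
  ∀ 𝓕 : MeasurableSpace X, @IsFactor G X _ _ 𝓕 mX → @IsNontrivialAlgebra X 𝓕 mX μ →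
    0 < @factorPEntropy G X _ _ 𝓕 mX μ P

/-- The restriction of the action on `(Z, lam)` to the invariant σ-algebra `𝓕` is isomorphic to the
action on `(X, μ)`. For standard spaces this means that there is a measure-preserving, almost
everywhere equivariant map `π : Z → X` such that `𝓕` coincides modulo null sets with the
σ-algebra of the sets `π ⁻¹' B`. -/
def IsFactorIsomorphicTo (G : Type*) {Z X : Type*} [Group G] (𝓕 : MeasurableSpace Z)
    [MulAction G Z] [MeasurableSpace Z] [MulAction G X] [MeasurableSpace X]
    (lam : Measure Z) (μ : Measure X) : Prop :=
  IsFactor G 𝓕 ∧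
  ∃ π : Z → X, MeasurePreserving π lam μ ∧
    (∀ g : G, ∀ᵐ z ∂lam, π (g • z) = g • π z) ∧
    (∀ A : Set Z, MeasurableSet[𝓕] A → ∃ B : Set X, MeasurableSet B ∧ A =ᵐ[lam] π ⁻¹' B) ∧
    (∀ B : Set X, MeasurableSet B → ∃ A : Set Z, MeasurableSet[𝓕] A ∧ A =ᵐ[lam] π ⁻¹' B)

/-- The Koopman operator `f ↦ f ∘ T_g` on `L²(μ)`. -/
def koopman {G X : Type*} [Group G] [MulAction G X] [MeasurableSpace X] [MeasurableConstSMul G X]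
    (μ : Measure X) [SMulInvariantMeasure G X μ] (g : G) (f : Lp ℝ 2 μ) : Lp ℝ 2 μ :=
  Lp.compMeasurePreserving (g • ·) (measurePreserving_smul g μ) f

/-- A Markov operator `J : L²(μ) → L²(ν)` intertwining the two actions: `J` preserves
nonnegativity, `J` and its adjoint fix the constants, and `J` commutes with the actions. -/
structure IsMarkovIntertwining (G : Type*) {X Y : Type*} [Group G]
    [MulAction G X] [MeasurableSpace X] [MeasurableConstSMul G X]
    [MulAction G Y] [MeasurableSpace Y] [MeasurableConstSMul G Y]
    (μ : Measure X) [IsProbabilityMeasure μ] [SMulInvariantMeasure G X μ]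
    (ν : Measure Y) [IsProbabilityMeasure ν] [SMulInvariantMeasure G Y ν]
    (J : Lp ℝ 2 μ →L[ℝ] Lp ℝ 2 ν) : Prop where
  nonneg : ∀ f : Lp ℝ 2 μ, 0 ≤ f → 0 ≤ J f
  map_one : J (Lp.const 2 μ 1) = Lp.const 2 ν 1
  adjoint_one : ContinuousLinearMap.adjoint J (Lp.const 2 ν 1) = Lp.const 2 μ 1
  intertwines : ∀ (g : G) (f : Lp ℝ 2 μ), J (koopman μ g f) = koopman ν g (J f)

/-- Disjointness: there is no nontrivial Markov intertwining, that is, the only one is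
`f ↦ ∫ f dμ`. -/
def AreDisjoint (G : Type*) {X Y : Type*} [Group G]
    [MulAction G X] [MeasurableSpace X] [MeasurableConstSMul G X]
    [MulAction G Y] [MeasurableSpace Y] [MeasurableConstSMul G Y]
    (μ : Measure X) [IsProbabilityMeasure μ] [SMulInvariantMeasure G X μ]
    (ν : Measure Y) [IsProbabilityMeasure ν] [SMulInvariantMeasure G Y ν] : Prop :=
  ∀ J : Lp ℝ 2 μ →L[ℝ] Lp ℝ 2 ν, IsMarkovIntertwining G μ ν J →
    ∀ f : Lp ℝ 2 μ, J f = Lp.const 2 ν (∫ x, f x ∂μ)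

end PEntropy

end

/-! Let `J` intertwine `T` and `S`, and let `u` be a version of `J* 1_B`; thinking of `J*` as a
transition kernel from `X` to `Y`, `u x` is the probability that a point of `Y` drawn at `x` lies
in `B`. Draw `N` such points independently given `x`. The names of the `N` points under a finite
partition `θ` of `Y` have entropy at most `N` times that of `S`, so they grow at rate zero along
`P`. On the other hand, by the law of large numbers the samples determine `u x`, hence its level
sets, up to a small error. The sets of `X` that can be recovered from samples in this way form a
`T`-invariant σ-algebra, and subadditivity of conditional entropy shows that its `P`-entropy is
zero: the entropy of a join over `P_j` is at most that of the samples plus `|P_j|` times the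
conditional entropy of a single partition given its samples, which is small by a Fano type bound.
Complete positivity makes this σ-algebra trivial, so `u` is constant.

Independence follows by applying disjointness to the Markov operator that lifts functions along
one factor map and then takes conditional expectation along the other. -/
noncomputable section

namespace PEntropy

open Function Set
open Real (negMulLog)
open scoped ENNReal Topology symmDiff

section Entropy

lemma negMulLog_add_mul_log_le {a b : ℝ} (ha : 0 ≤ a) (hb : 0 ≤ b) (hab : b = 0 → a = 0) :
    negMulLog a + a * Real.log b ≤ b - a := by
  rcases ha.eq_or_lt with rfl | ha
  · simpa using hb
  have hb : 0 < b := hb.lt_of_ne fun h => ha.ne' (hab h.symm)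
  have hlog : Real.log b - Real.log a ≤ b / a - 1 :=
    Real.log_div hb.ne' ha.ne' ▸ Real.log_le_sub_one_of_pos (div_pos hb ha)
  calc negMulLog a + a * Real.log b = a * (Real.log b - Real.log a) := by rw [negMulLog]; ring
    _ ≤ a * (b / a - 1) := by gcongr
    _ = b - a := by field_simp

lemma negMulLog_sum_le {α : Type*} (s : Finset α) (p : α → ℝ) (hp : ∀ a ∈ s, 0 ≤ p a) :
    negMulLog (∑ a ∈ s, p a) ≤ ∑ a ∈ s, negMulLog (p a) := by
  rw [negMulLog, neg_mul, Finset.sum_mul, ← Finset.sum_neg_distrib]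
  refine Finset.sum_le_sum fun a ha => ?_
  rcases (hp a ha).eq_or_lt with h | h
  · simp [← h]
  · rw [negMulLog, neg_mul, neg_le_neg_iff]
    gcongr
    exact Finset.single_le_sum hp ha

lemma negMulLog_add_mul_log_add_sub_le {a r c t : ℝ} (ha : 0 ≤ a) (har : a ≤ r) (hac : a ≤ c)
    (hrt : r ≤ t) :
    negMulLog a + a * (Real.log r + Real.log c - Real.log t) ≤ r * c / t - a := by
  rcases ha.eq_or_lt with rfl | ha
  · simpa using div_nonneg (mul_nonneg har hac) (har.trans hrt)
  have hr : 0 < r := ha.trans_le har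
  have hc : 0 < c := ha.trans_le hac
  have ht : 0 < t := hr.trans_le hrt
  rw [← Real.log_mul hr.ne' hc.ne', ← Real.log_div (by positivity) ht.ne']
  exact negMulLog_add_mul_log_le ha.le (by positivity) fun h0 => absurd h0 (by positivity)

lemma negMulLog_submodular {α β : Type*} [Fintype α] [Fintype β] (a : α → β → ℝ)
    (ha : ∀ i j, 0 ≤ a i j) :
    ∑ i, ∑ j, negMulLog (a i j) + negMulLog (∑ i, ∑ j, a i j) ≤
      ∑ i, negMulLog (∑ j, a i j) + ∑ j, negMulLog (∑ i, a i j) := by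
  set r : α → ℝ := fun i => ∑ j, a i j with hr
  set c : β → ℝ := fun j => ∑ i, a i j with hc
  set t : ℝ := ∑ i, r i with ht
  have hct : ∑ j, c j = t := Finset.sum_comm
  have hr0 : ∀ i, 0 ≤ r i := fun i => Finset.sum_nonneg fun j _ => ha i j
  have har : ∀ i j, a i j ≤ r i := fun i j =>
    Finset.single_le_sum (fun j _ => ha i j) (Finset.mem_univ j)
  have hac : ∀ i j, a i j ≤ c j := fun i j =>
    Finset.single_le_sum (f := fun i => a i j) (fun i _ => ha i j) (Finset.mem_univ i)
  have hrt : ∀ i, r i ≤ t := fun i => Finset.single_le_sum (fun i _ => hr0 i) (Finset.mem_univ i)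
  have cell (i : α) (j : β) := negMulLog_add_mul_log_add_sub_le (ha i j) (har i j) (hac i j) (hrt i)
  have hdev : ∑ i, ∑ j, (r i * c j / t - a i j) = 0 := by
    simp only [Finset.sum_sub_distrib, ← Finset.sum_div, ← Finset.mul_sum, hct, ← Finset.sum_mul]
    rw [← ht, mul_self_div_self, sub_self]
  have hlog : ∑ i, ∑ j, a i j * (Real.log (r i) + Real.log (c j) - Real.log t) =
      ∑ i, r i * Real.log (r i) + ∑ j, c j * Real.log (c j) - t * Real.log t := by
    simp only [mul_sub, mul_add, Finset.sum_sub_distrib, Finset.sum_add_distrib, ← Finset.sum_mul]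
    rw [Finset.sum_comm (f := fun i j => a i j * Real.log (c j))]
    simp only [← Finset.sum_mul, hr, hc, ht]
  have hsum := Finset.sum_le_sum fun i (_ : i ∈ Finset.univ) =>
    Finset.sum_le_sum fun j (_ : j ∈ Finset.univ) => cell i j
  rw [hdev] at hsum
  simp only [Finset.sum_add_distrib, hlog] at hsum
  simp only [negMulLog, neg_mul, Finset.sum_neg_distrib] at hsum ⊢
  linarith

variable {Ω Ω' ι α β γ : Type*} [MeasurableSpace Ω] [MeasurableSpace Ω'] {ρ : Measure Ω}
  [Fintype ι] [Fintype α] [MeasurableSpace α] [MeasurableSingletonClass α]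
  [Fintype β] [MeasurableSpace β] [MeasurableSingletonClass β] [Fintype γ]

lemma entropy_eq_sum_negMulLog (f : Ω → ι) :
    entropy ρ f = ∑ i, negMulLog (ρ.real (f ⁻¹' {i})) := by
  simp [entropy, negMulLog]

lemma entropy_map {T : Ω → Ω'} (hT : Measurable T) {f : Ω' → α} (hf : Measurable f) :
    entropy (ρ.map T) f = entropy ρ (f ∘ T) := by
  simp only [entropy, preimage_comp]
  congr 2 with i
  rw [map_measureReal_apply hT (hf (measurableSet_singleton i))]

lemma sum_measureReal_preimage_inter [IsFiniteMeasure ρ] {f : Ω → α} (hf : Measurable f)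
    (s : Set Ω) : ∑ a, ρ.real (f ⁻¹' {a} ∩ s) = ρ.real s := by
  simp only [← measureReal_restrict_apply (hf (measurableSet_singleton _))]
  rw [sum_measureReal_preimage_singleton _ fun a _ => hf (measurableSet_singleton a)]
  simp

lemma entropy_comp_le [IsFiniteMeasure ρ] {f : Ω → α} (hf : Measurable f) (φ : α → ι) :
    entropy ρ (φ ∘ f) ≤ entropy ρ f := by
  classical
  simp only [entropy_eq_sum_negMulLog]
  rw [← Finset.sum_fiberwise (s := Finset.univ) (g := φ)]
  refine Finset.sum_le_sum fun i _ => ?_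
  have hcell : ρ.real (φ ∘ f ⁻¹' {i}) = ∑ a with φ a = i, ρ.real (f ⁻¹' {a}) := by
    rw [sum_measureReal_preimage_singleton _ fun a _ => hf (measurableSet_singleton a)]
    congr 1
    ext
    simp
  exact hcell ▸ negMulLog_sum_le _ _ fun a _ => measureReal_nonneg

lemma entropy_le_of_factorsThrough [IsFiniteMeasure ρ] {f : Ω → ι} {g : Ω → α} (hg : Measurable g)
    (hfg : f.FactorsThrough g) : entropy ρ f ≤ entropy ρ g := by
  cases isEmpty_or_nonempty Ω
  · simp [entropy, Measure.eq_zero_of_isEmpty ρ]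
  · have : Nonempty ι := ⟨f (Classical.arbitrary Ω)⟩
    obtain ⟨φ, rfl⟩ := (factorsThrough_iff f).1 hfg
    exact entropy_comp_le hg φ

lemma entropy_submodular [IsFiniteMeasure ρ] {f : Ω → α} {g : Ω → β} {h : Ω → γ}
    (hf : Measurable f) (hg : Measurable g) :
    entropy ρ (fun ω => (h ω, f ω, g ω)) + entropy ρ h ≤
      entropy ρ (fun ω => (h ω, f ω)) + entropy ρ (fun ω => (h ω, g ω)) := by
  simp only [entropy_eq_sum_negMulLog, Fintype.sum_prod_type, ← Finset.sum_add_distrib]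
  refine Finset.sum_le_sum fun c _ => ?_
  set m : α → β → ℝ := fun a b => ρ.real ((fun ω => (h ω, f ω, g ω)) ⁻¹' {(c, a, b)})
  have sum_left : ∀ a, ρ.real ((fun ω => (h ω, f ω)) ⁻¹' {(c, a)}) = ∑ b, m a b := fun a => by
    rw [← sum_measureReal_preimage_inter hg]
    refine Finset.sum_congr rfl fun b _ => congrArg ρ.real ?_
    ext
    simp only [mem_inter_iff, mem_preimage, mem_singleton_iff, Prod.mk.injEq]
    tauto
  have sum_right : ∀ b, ρ.real ((fun ω => (h ω, g ω)) ⁻¹' {(c, b)}) = ∑ a, m a b := fun b => by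
    rw [← sum_measureReal_preimage_inter hf]
    refine Finset.sum_congr rfl fun a _ => congrArg ρ.real ?_
    ext
    simp only [mem_inter_iff, mem_preimage, mem_singleton_iff, Prod.mk.injEq]
    tauto
  have sum_both : ρ.real (h ⁻¹' {c}) = ∑ a, ∑ b, m a b := by
    simp only [← sum_left]
    rw [← sum_measureReal_preimage_inter hf]
    refine Finset.sum_congr rfl fun a _ => congrArg ρ.real ?_
    ext
    simp only [mem_inter_iff, mem_preimage, mem_singleton_iff, Prod.mk.injEq]
    tauto
  rw [sum_both]
  simp only [sum_left, sum_right]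
  exact negMulLog_submodular m fun _ _ => measureReal_nonneg

end Entropy

section CondEntropy

variable {Ω Ω' F ι α β γ : Type*} [MeasurableSpace Ω] [MeasurableSpace Ω'] {ρ : Measure Ω}
  [Fintype α] [MeasurableSpace α] [MeasurableSingletonClass α]
  [Fintype β] [MeasurableSpace β] [MeasurableSingletonClass β]
  [Fintype γ] [MeasurableSpace γ] [MeasurableSingletonClass γ]

/-- The conditional entropy `H(f | h)` of the finite partition labelled by `f` given the one
labelled by `h`. -/
def condEntropy [Fintype ι] (ρ : Measure Ω) (f : Ω → ι) (h : Ω → α) : ℝ :=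
  entropy ρ (fun ω => (h ω, f ω)) - entropy ρ h

lemma condEntropy_map {T : Ω → Ω'} (hT : Measurable T) {f : Ω' → α} (hf : Measurable f)
    {h : Ω' → β} (hh : Measurable h) :
    condEntropy (ρ.map T) f h = condEntropy ρ (f ∘ T) (h ∘ T) := by
  simp only [condEntropy, entropy_map hT hh, entropy_map hT (hh.prodMk hf)]
  rfl

lemma entropy_le_entropy_add_condEntropy [IsFiniteMeasure ρ] {f : Ω → α} (hf : Measurable f)
    {h : Ω → β} (hh : Measurable h) : entropy ρ f ≤ entropy ρ h + condEntropy ρ f h := by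
  have := entropy_le_of_factorsThrough (ρ := ρ) (f := f) (hh.prodMk hf)
    fun _ _ h => congrArg Prod.snd h
  rw [condEntropy]
  linarith

lemma condEntropy_le_of_factorsThrough [IsFiniteMeasure ρ] {f : Ω → α} (hf : Measurable f)
    {g : Ω → β} (hg : Measurable g) {h : Ω → γ} (hh : Measurable h) (hhg : h.FactorsThrough g) :
    condEntropy ρ f g ≤ condEntropy ρ f h := by
  have hsub := entropy_submodular (ρ := ρ) (h := h) hf hg
  have hgf : entropy ρ (fun ω => (g ω, f ω)) ≤ entropy ρ (fun ω => (h ω, f ω, g ω)) :=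
    entropy_le_of_factorsThrough (by fun_prop) fun ω ω' e => by simp_all
  have hhg : entropy ρ (fun ω => (h ω, g ω)) ≤ entropy ρ g :=
    entropy_le_of_factorsThrough hg fun ω ω' e => Prod.ext (hhg e) e
  rw [condEntropy, condEntropy]
  linarith

lemma condEntropy_restrict_le_sum [IsFiniteMeasure ρ] [DecidableEq F] (S : Finset F)
    {f : F → Ω → α} (hf : ∀ p, Measurable (f p)) {h : Ω → β} (hh : Measurable h) :
    condEntropy ρ (fun ω (p : S) => f p ω) h ≤ ∑ p ∈ S, condEntropy ρ (f p) h := by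
  induction S using Finset.induction_on with
  | empty =>
    have := entropy_le_of_factorsThrough (ρ := ρ)
      (f := fun ω => (h ω, fun p : (∅ : Finset F) => f p ω)) hh
      fun ω ω' e => Prod.ext e (Subsingleton.elim _ _)
    simpa [condEntropy]
  | insert q S hq ih =>
    have hsub := entropy_submodular (ρ := ρ) (hf q)
      (g := fun ω (p : S) => f p ω) (h := h) (by fun_prop)
    have hins : entropy ρ (fun ω => (h ω, fun p : (insert q S : Finset F) => f p ω)) ≤
        entropy ρ (fun ω => (h ω, f q ω, fun p : S => f p ω)) := by
      refine entropy_le_of_factorsThrough (by fun_prop) fun ω ω' e => ?_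
      simp only [Prod.mk.injEq] at e ⊢
      refine ⟨e.1, funext fun ⟨p, hp⟩ => ?_⟩
      rcases Finset.mem_insert.1 hp with rfl | hp
      exacts [e.2.1, congrFun e.2.2 ⟨p, hp⟩]
    rw [Finset.sum_insert hq]
    simp only [condEntropy] at ih ⊢
    linarith

lemma entropy_pi_le_sum [IsProbabilityMeasure ρ] [Fintype F] [DecidableEq F]
    {f : F → Ω → α} (hf : ∀ p, Measurable (f p)) :
    entropy ρ (fun ω p => f p ω) ≤ ∑ p, entropy ρ (f p) := by
  have huniv : entropy ρ (fun ω p => f p ω) ≤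
      entropy ρ (fun ω (p : (Finset.univ : Finset F)) => f p ω) :=
    entropy_le_of_factorsThrough (by fun_prop)
      fun ω ω' e => funext fun p => congrFun e ⟨p, Finset.mem_univ p⟩
  have hconst : entropy ρ (fun _ => ()) = 0 := by simp [entropy]
  calc entropy ρ (fun ω p => f p ω)
      ≤ entropy ρ (fun _ => ()) +
          condEntropy ρ (fun ω (p : (Finset.univ : Finset F)) => f p ω) (fun _ => ()) :=
        huniv.trans (entropy_le_entropy_add_condEntropy (by fun_prop) measurable_const)
    _ ≤ ∑ p, condEntropy ρ (f p) (fun _ => ()) := by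
        rw [hconst, zero_add]
        exact condEntropy_restrict_le_sum _ hf measurable_const
    _ ≤ ∑ p, entropy ρ (f p) := by
        refine Finset.sum_le_sum fun p _ => ?_
        rw [condEntropy, hconst, sub_zero]
        exact entropy_le_of_factorsThrough (hf p) fun _ _ e => Prod.ext rfl e

lemma negMulLog_add_mul_log_le_of_deviation {ε a e p : ℝ} (hε : 0 < ε) (ha : 0 ≤ a) (hap : a ≤ p)
    (he : e = a ∨ e = p - a) :
    negMulLog a + a * Real.log p ≤ ε * p + max 1 (-Real.log ε) * e := by
  have hp : 0 ≤ p := ha.trans hap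
  rcases he with rfl | rfl
  · have hle := negMulLog_add_mul_log_le ha (mul_nonneg hε.le hp)
      fun h => by rcases mul_eq_zero.1 h with h | h <;> linarith
    have hlog : e * Real.log (ε * p) = e * Real.log ε + e * Real.log p := by
      rcases hp.eq_or_lt with rfl | hp
      · simp [le_antisymm hap ha]
      · rw [Real.log_mul hε.ne' hp.ne', mul_add]
    have hmax := mul_le_mul_of_nonneg_right (le_max_right 1 (-Real.log ε)) ha
    linarith
  · have hle := negMulLog_add_mul_log_le ha hp fun h => by linarith
    have hmax := mul_le_mul_of_nonneg_right (le_max_left 1 (-Real.log ε)) (sub_nonneg.2 hap)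
    have := mul_nonneg hε.le hp
    linarith

lemma condEntropy_eq_sum [Fintype ι] [IsFiniteMeasure ρ] {f : Ω → α} (hf : Measurable f)
    {h : Ω → ι} :
    condEntropy ρ f h = ∑ b, ∑ a, (negMulLog (ρ.real (f ⁻¹' {a} ∩ h ⁻¹' {b})) +
      ρ.real (f ⁻¹' {a} ∩ h ⁻¹' {b}) * Real.log (ρ.real (h ⁻¹' {b}))) := by
  simp only [condEntropy, entropy_eq_sum_negMulLog, Fintype.sum_prod_type,
    Finset.sum_add_distrib, ← Finset.sum_mul, sum_measureReal_preimage_inter hf]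
  rw [sub_eq_add_neg, ← Finset.sum_neg_distrib]
  congr 1
  · refine Finset.sum_congr rfl fun b _ => Finset.sum_congr rfl fun a _ => ?_
    congr 2
    ext
    simp [and_comm]
  · simp [negMulLog]

lemma preimage_singleton_inter_symmDiff {Ω α β : Type*} {f : Ω → α} {h : Ω → β} (a : α) (b : β)
    (D : Set β) : h ⁻¹' {b} ∩ (f ⁻¹' {a}) ∆ (h ⁻¹' D) = f ⁻¹' {a} ∩ h ⁻¹' {b} ∨
      h ⁻¹' {b} ∩ (f ⁻¹' {a}) ∆ (h ⁻¹' D) = h ⁻¹' {b} \ f ⁻¹' {a} := by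
  by_cases hb : b ∈ D
  · right
    ext ω
    simp only [mem_inter_iff, mem_symmDiff, mem_preimage, mem_singleton_iff, Set.mem_sdiff]
    constructor
    all_goals rintro ⟨rfl, h⟩; tauto
  · left
    ext ω
    simp only [mem_inter_iff, mem_symmDiff, mem_preimage, mem_singleton_iff]
    constructor
    · rintro ⟨rfl, h⟩; tauto
    · rintro ⟨h, rfl⟩; tauto

lemma condEntropy_le_of_decision [IsFiniteMeasure ρ] {f : Ω → α} (hf : Measurable f)
    {h : Ω → β} (hh : Measurable h) (D : α → Set β) {ε : ℝ} (hε : 0 < ε) :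
    condEntropy ρ f h ≤ Fintype.card α * ε * ρ.real univ +
      max 1 (-Real.log ε) * ∑ a, ρ.real ((f ⁻¹' {a}) ∆ (h ⁻¹' D a)) := by
  set p : β → ℝ := fun b => ρ.real (h ⁻¹' {b})
  set q : β → α → ℝ := fun b a => ρ.real (f ⁻¹' {a} ∩ h ⁻¹' {b})
  set e : β → α → ℝ := fun b a => ρ.real (h ⁻¹' {b} ∩ (f ⁻¹' {a}) ∆ (h ⁻¹' D a)) with he_def
  have hdev (b : β) (a : α) : e b a = q b a ∨ e b a = p b - q b a := by
    refine (preimage_singleton_inter_symmDiff a b (D a)).imp (congrArg ρ.real) fun h' => ?_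
    simp only [he_def, h', p, q]
    rw [inter_comm, eq_sub_iff_add_eq',
      measureReal_inter_add_sdiff (hf (measurableSet_singleton a))]
  have hp : ∑ b, p b = ρ.real univ := by
    simpa using sum_measureReal_preimage_inter (ρ := ρ) hh univ
  have he : ∑ b, ∑ a, e b a = ∑ a, ρ.real ((f ⁻¹' {a}) ∆ (h ⁻¹' D a)) := by
    rw [Finset.sum_comm]
    simp only [e, sum_measureReal_preimage_inter hh]
  calc condEntropy ρ f h
      ≤ ∑ b, ∑ a, (ε * p b + max 1 (-Real.log ε) * e b a) := by
        rw [condEntropy_eq_sum hf]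
        exact Finset.sum_le_sum fun b _ => Finset.sum_le_sum fun a _ =>
          negMulLog_add_mul_log_le_of_deviation hε measureReal_nonneg
            (measureReal_mono inter_subset_right) (hdev b a)
    _ = _ := by
        simp only [Finset.sum_add_distrib, Finset.sum_const, Finset.card_univ, nsmul_eq_mul,
          ← Finset.mul_sum, hp, he]
        ring

end CondEntropy

section Sampling

/-- A version `k B` of the images `K 1_B` of indicators under an equivariant Markov operator
`K : L²(ν) → L²(μ)`; for standard spaces, `k B x` is the mass of `B` under a transition kernel. -/
structure IsMarkovFamily (G : Type*) {X Y : Type*} [Group G]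
    [MulAction G X] [MeasurableSpace X] [MulAction G Y] [MeasurableSpace Y]
    (μ : Measure X) (ν : Measure Y) (k : Set Y → X → ℝ) : Prop where
  measurable : ∀ B, MeasurableSet B → Measurable (k B)
  nonneg : ∀ B, MeasurableSet B → ∀ᵐ x ∂μ, 0 ≤ k B x
  union : ∀ B C, MeasurableSet B → MeasurableSet C → Disjoint B C →
    ∀ᵐ x ∂μ, k (B ∪ C) x = k B x + k C x
  univ : ∀ᵐ x ∂μ, k univ x = 1
  integral : ∀ B, MeasurableSet B → ∫ x, k B x ∂μ = ν.real B
  smul : ∀ (g : G) (B : Set Y), MeasurableSet B →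
    ∀ᵐ x ∂μ, k ((g • ·) ⁻¹' B) x = k B (g • x)

variable {G X Y κ κ' : Type*} [Group G] [MulAction G X] [MeasurableSpace X]
  [MulAction G Y] [MeasurableSpace Y] {μ : Measure X} {ν : Measure Y} {k : Set Y → X → ℝ}

/-- The joint law of a point `x` with law `μ` and of the labels `θ y₁, …, θ y_N`, where
`y₁, …, y_N` are drawn from `k · x`, independently given `x`. -/
def sampleLaw [Fintype κ] [MeasurableSpace κ] (μ : Measure X) (k : Set Y → X → ℝ) (θ : Y → κ)
    (N : ℕ) : Measure (X × (Fin N → κ)) :=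
  ∑ c : Fin N → κ, (μ.withDensity fun x => ENNReal.ofReal (∏ m, k (θ ⁻¹' {c m}) x)).map (·, c)

lemma measure_ext_prod_singleton [Finite κ] [MeasurableSpace κ] [MeasurableSingletonClass κ]
    {m m' : Measure (X × κ)}
    (h : ∀ A, MeasurableSet A → ∀ c, m (A ×ˢ {c}) = m' (A ×ˢ {c})) : m = m' := by
  ext S hS
  have hslice (c : κ) : MeasurableSet {x | (x, c) ∈ S} := measurable_prodMk_right hS
  have hS' : S = ⋃ c, {x | (x, c) ∈ S} ×ˢ {c} := by ext ⟨x, c⟩; simp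
  have hdisj : Pairwise (Disjoint on fun c => {x | (x, c) ∈ S} ×ˢ ({c} : Set κ)) :=
    fun c c' hc => Disjoint.set_prod_right (by simpa using hc) _ _
  rw [hS', measure_iUnion hdisj fun c => (hslice c).prod (measurableSet_singleton c),
    measure_iUnion hdisj fun c => (hslice c).prod (measurableSet_singleton c)]
  exact tsum_congr fun c => h _ (hslice c) c

lemma measurable_joinTranslates [MeasurableConstSMul G Y] [MeasurableSpace κ] {θ : Y → κ}
    (hθ : Measurable θ) (F : Finset G) : Measurable (joinTranslates F θ) :=
  measurable_pi_lambda _ fun p => hθ.comp (measurable_const_smul (p : G)⁻¹)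

namespace IsMarkovFamily

lemma empty (hk : IsMarkovFamily G μ ν k) : ∀ᵐ x ∂μ, k ∅ x = 0 := by
  filter_upwards [hk.union ∅ ∅ .empty .empty disjoint_bot_left] with x hx
  simpa using hx

variable [MeasurableSpace κ] [MeasurableSingletonClass κ]

lemma sum_preimage (hk : IsMarkovFamily G μ ν k) {θ : Y → κ} (hθ : Measurable θ) (t : Finset κ) :
    ∀ᵐ x ∂μ, ∑ c ∈ t, k (θ ⁻¹' {c}) x = k (θ ⁻¹' t) x := by
  classical
  induction t using Finset.induction_on with
  | empty => filter_upwards [hk.empty] with x hx; simp [hx]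
  | insert a t ha ih =>
    filter_upwards [ih, hk.union (θ ⁻¹' {a}) (θ ⁻¹' t) (hθ (measurableSet_singleton a))
      (hθ t.measurableSet) (Disjoint.preimage _ (by simpa using ha))] with x hsum hunion
    rw [Finset.sum_insert ha, hsum, ← hunion, Finset.coe_insert, insert_eq, preimage_union]

lemma nonneg_preimage [Countable κ] (hk : IsMarkovFamily G μ ν k) {θ : Y → κ}
    (hθ : Measurable θ) : ∀ᵐ x ∂μ, ∀ c, 0 ≤ k (θ ⁻¹' {c}) x :=
  ae_all_iff.2 fun _ => hk.nonneg _ (hθ (measurableSet_singleton _))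

lemma measurable_weight (hk : IsMarkovFamily G μ ν k) {θ : Y → κ} (hθ : Measurable θ) {N : ℕ}
    (c : Fin N → κ) : Measurable fun x => ENNReal.ofReal (∏ m, k (θ ⁻¹' {c m}) x) :=
  ENNReal.measurable_ofReal.comp
    (Finset.measurable_fun_prod _ fun _ _ => hk.measurable _ (hθ (measurableSet_singleton _)))

variable [Fintype κ]

lemma sum_preimage_univ (hk : IsMarkovFamily G μ ν k) {θ : Y → κ} (hθ : Measurable θ) :
    ∀ᵐ x ∂μ, ∑ c, k (θ ⁻¹' {c}) x = 1 := by
  filter_upwards [hk.sum_preimage hθ Finset.univ, hk.univ] with x hsum huniv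
  rw [hsum, Finset.coe_univ, preimage_univ, huniv]

lemma lintegral_sampleLaw (hk : IsMarkovFamily G μ ν k) {θ : Y → κ} (hθ : Measurable θ) {N : ℕ}
    {F : X × (Fin N → κ) → ℝ≥0∞} (hF : Measurable F) :
    ∫⁻ ω, F ω ∂(sampleLaw μ k θ N) =
      ∫⁻ x, ∑ c, ENNReal.ofReal (∏ m, k (θ ⁻¹' {c m}) x) * F (x, c) ∂μ := by
  have hslice (c : Fin N → κ) : Measurable fun x => F (x, c) := by fun_prop
  rw [sampleLaw, lintegral_finsetSum_measure,
    lintegral_finsetSum _ fun c _ => (hk.measurable_weight hθ c).fun_mul (hslice c)]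
  refine Finset.sum_congr rfl fun c _ => ?_
  rw [lintegral_map hF (by fun_prop),
    lintegral_withDensity_eq_lintegral_mul _ (hk.measurable_weight hθ c) (hslice c)]
  rfl

lemma sampleLaw_prod_piFinset (hk : IsMarkovFamily G μ ν k) {θ : Y → κ} (hθ : Measurable θ) {N : ℕ}
    {A : Set X} (hA : MeasurableSet A) (t : Fin N → Finset κ) :
    sampleLaw μ k θ N (A ×ˢ Fintype.piFinset t) =
      ∫⁻ x in A, ENNReal.ofReal (∏ m, k (θ ⁻¹' t m) x) ∂μ := by
  have hS : MeasurableSet (A ×ˢ (Fintype.piFinset t : Set (Fin N → κ))) :=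
    hA.prod (Finset.measurableSet _)
  rw [← lintegral_indicator_one hS, hk.lintegral_sampleLaw hθ (measurable_one.indicator hS),
    ← lintegral_indicator hA]
  refine lintegral_congr_ae ?_
  filter_upwards [hk.nonneg_preimage hθ, ae_all_iff.2 fun m => hk.sum_preimage hθ (t m)]
    with x hnonneg hsum
  by_cases hx : x ∈ A
  · simp only [indicator_of_mem hx, ← hsum, Finset.prod_univ_sum]
    rw [ENNReal.ofReal_sum_of_nonneg fun c _ => Finset.prod_nonneg fun m _ => hnonneg _]
    simp only [indicator, Pi.one_apply, mul_ite, mul_one, mul_zero, ← Finset.sum_filter]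
    exact Finset.sum_congr (by ext; simp [hx]) fun _ _ => rfl
  · simp [indicator, hx]

lemma sampleLaw_prod_univ (hk : IsMarkovFamily G μ ν k) {θ : Y → κ} (hθ : Measurable θ) (N : ℕ)
    {A : Set X} (hA : MeasurableSet A) : sampleLaw μ k θ N (A ×ˢ Set.univ) = μ A := by
  have h := hk.sampleLaw_prod_piFinset hθ hA fun _ : Fin N => Finset.univ
  simp only [Fintype.piFinset_univ, Finset.coe_univ, preimage_univ] at h
  rw [h, ← setLIntegral_one]
  refine lintegral_congr_ae (ae_restrict_of_ae ?_)
  filter_upwards [hk.univ] with x hx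
  simp [hx]

lemma map_fst_sampleLaw (hk : IsMarkovFamily G μ ν k) {θ : Y → κ} (hθ : Measurable θ) (N : ℕ) :
    (sampleLaw μ k θ N).map Prod.fst = μ := by
  ext A hA
  rw [Measure.map_apply measurable_fst hA, ← prod_univ, hk.sampleLaw_prod_univ hθ N hA]

lemma isProbabilityMeasure_sampleLaw [IsProbabilityMeasure μ] (hk : IsMarkovFamily G μ ν k)
    {θ : Y → κ} (hθ : Measurable θ) (N : ℕ) : IsProbabilityMeasure (sampleLaw μ k θ N) :=
  ⟨by rw [← univ_prod_univ, hk.sampleLaw_prod_univ hθ N .univ, measure_univ]⟩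

variable [MeasurableSpace κ'] [MeasurableSingletonClass κ'] [Fintype κ']

lemma map_sampleLaw [MeasurableConstSMul G X] [SMulInvariantMeasure G X μ]
    (hk : IsMarkovFamily G μ ν k) {θ : Y → κ} (hθ : Measurable θ) {η : Y → κ'} (hη : Measurable η)
    (g : G) {φ : κ → κ'} (hφ : ∀ y, φ (θ y) = η (g • y)) {N N' : ℕ} {e : Fin N → Fin N'}
    (he : Injective e) :
    (sampleLaw μ k θ N').map (fun ω => (g • ω.1, fun m => φ (ω.2 (e m)))) = sampleLaw μ k η N := by
  classical
  refine measure_ext_prod_singleton fun A hA c => ?_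
  have hg : Measurable fun x : X => g • x := measurable_const_smul g
  set t : Fin N' → Finset κ := fun m' => {a | ∀ m, e m = m' → φ a = c m}
  have hpre : (fun ω : X × (Fin N' → κ) => (g • ω.1, fun m => φ (ω.2 (e m)))) ⁻¹' (A ×ˢ {c}) =
      ((g • ·) ⁻¹' A) ×ˢ Fintype.piFinset t := by
    ext ω
    simp [t, funext_iff, @forall_comm (Fin N')]
  have hsingleton : ({c} : Set (Fin N → κ')) = Fintype.piFinset fun m => {c m} := by
    simp
  rw [Measure.map_apply (by fun_prop) (hA.prod (measurableSet_singleton c)), hpre,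
    hk.sampleLaw_prod_piFinset hθ (hg hA), hsingleton, hk.sampleLaw_prod_piFinset hη hA]
  simp only [Finset.coe_singleton]
  rw [← (measurePreserving_smul g μ).setLIntegral_comp_preimage hA (hk.measurable_weight hη c)]
  refine lintegral_congr_ae (ae_restrict_of_ae ?_)
  filter_upwards [hk.univ, ae_all_iff.2 fun m => hk.smul g (η ⁻¹' {c m})
    (hη (measurableSet_singleton _))] with x huniv hsmul
  congr 1
  refine (Fintype.prod_of_injective e he _ _ (fun m' hm' => ?_) fun m => ?_).symm
  -- A coordinate outside the range of `e` is unconstrained and contributes the factor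
  -- `k univ x = 1`.
  · have : t m' = Finset.univ :=
      Finset.filter_true_of_mem fun _ _ m hm => absurd ⟨m, hm⟩ hm'
    rw [this]
    simp [huniv]
  · have : θ ⁻¹' t (e m) = (g • ·) ⁻¹' (η ⁻¹' {c m}) := by
      ext y
      simp [t, he.eq_iff, hφ]
    rw [← hsmul m, this]

lemma entropy_sampleLaw_eval [MeasurableConstSMul G X]
    [SMulInvariantMeasure G X μ] (hk : IsMarkovFamily G μ ν k) {θ : Y → κ} (hθ : Measurable θ)
    {N : ℕ} (m : Fin N) : entropy (sampleLaw μ k θ N) (fun ω => ω.2 m) = entropy ν θ := by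
  have hmap := hk.map_sampleLaw hθ hθ 1 (φ := id) (by simp) (e := fun _ : Fin 1 => m)
    (injective_of_subsingleton _)
  have hone : entropy (sampleLaw μ k θ 1) (fun ω => ω.2 0) =
      entropy (sampleLaw μ k θ N) (fun ω => ω.2 m) := by
    rw [← hmap, entropy_map (by fun_prop) (by fun_prop)]
    rfl
  rw [← hone]
  simp only [entropy_eq_sum_negMulLog]
  refine Finset.sum_congr rfl fun b _ => congrArg negMulLog ?_
  have hcell : (fun ω : X × (Fin 1 → κ) => ω.2 0) ⁻¹' {b} =
      Set.univ ×ˢ Fintype.piFinset fun _ => {b} := by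
    ext ω
    simp [funext_iff, Fin.forall_fin_one]
  have hB : MeasurableSet (θ ⁻¹' {b}) := hθ (measurableSet_singleton b)
  rw [measureReal_def, hcell, hk.sampleLaw_prod_piFinset hθ .univ, ← hk.integral _ hB,
    integral_eq_lintegral_of_nonneg_ae (hk.nonneg _ hB) (hk.measurable _ hB).aestronglyMeasurable]
  simp

open Classical in
lemma entropy_joinTranslates_le [IsProbabilityMeasure μ] [MeasurableConstSMul G X]
    [SMulInvariantMeasure G X μ] [MeasurableConstSMul G Y] (hk : IsMarkovFamily G μ ν k)
    {ξ : X → κ'} (hξ : Measurable ξ) {θ : Y → κ} (hθ : Measurable θ) (F : Finset G) (N : ℕ) :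
    entropy μ (joinTranslates F ξ) ≤ N * entropy ν (joinTranslates F θ) +
      F.card * condEntropy (sampleLaw μ k θ N) (fun ω => ξ ω.1) Prod.snd := by
  have hJξ (p : G) : Measurable (translatePartition p ξ) := hξ.comp (measurable_const_smul p⁻¹)
  have hJθ : Measurable (joinTranslates F θ) := measurable_joinTranslates hθ F
  set ρ := sampleLaw μ k (joinTranslates F θ) N
  have : IsProbabilityMeasure ρ := hk.isProbabilityMeasure_sampleLaw hJθ N
  have hsamples : entropy ρ Prod.snd ≤ N * entropy ν (joinTranslates F θ) := by
    refine (entropy_pi_le_sum (f := fun m (ω : X × (Fin N → F → κ)) => ω.2 m)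
      (by fun_prop)).trans_eq ?_
    simp [ρ, hk.entropy_sampleLaw_eval hJθ]
  have htranslate (p : G) (hp : p ∈ F) :
      condEntropy ρ (fun ω => translatePartition p ξ ω.1) Prod.snd ≤
        condEntropy (sampleLaw μ k θ N) (fun ω => ξ ω.1) Prod.snd := by
    have hmap := hk.map_sampleLaw hJθ hθ p⁻¹ (φ := fun a => a ⟨p, hp⟩) (fun _ => rfl)
      (injective_id (α := Fin N))
    rw [← hmap, condEntropy_map (by fun_prop) (by fun_prop) measurable_snd]
    exact condEntropy_le_of_factorsThrough ((hJξ p).comp measurable_fst) measurable_snd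
      (by fun_prop) fun ω ω' e => by simp [e]
  calc entropy μ (joinTranslates F ξ)
      = entropy ρ (joinTranslates F ξ ∘ Prod.fst) := by
        rw [← entropy_map measurable_fst (measurable_joinTranslates hξ F),
          hk.map_fst_sampleLaw hJθ N]
    _ ≤ entropy ρ Prod.snd + condEntropy ρ (joinTranslates F ξ ∘ Prod.fst) Prod.snd :=
        entropy_le_entropy_add_condEntropy
          ((measurable_joinTranslates hξ F).comp measurable_fst) measurable_snd
    _ ≤ N * entropy ν (joinTranslates F θ) +
          ∑ p ∈ F, condEntropy ρ (fun ω => translatePartition p ξ ω.1) Prod.snd :=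
        add_le_add hsamples (condEntropy_restrict_le_sum F
          (fun p => (hJξ p).comp measurable_fst) measurable_snd)
    _ ≤ _ := by
        gcongr
        simpa using Finset.sum_le_card_nsmul F _ _ htranslate

lemma meanEntropy_le [IsProbabilityMeasure μ] [MeasurableConstSMul G X]
    [SMulInvariantMeasure G X μ] [MeasurableConstSMul G Y] (hk : IsMarkovFamily G μ ν k)
    {r s : ℕ} {ξ : X → Fin r} (hξ : Measurable ξ) {θ : Y → Fin s} (hθ : Measurable θ)
    {F : Finset G} (hF : F.Nonempty) (N : ℕ) :
    meanEntropy μ F ξ ≤ N * meanEntropy ν F θ +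
      condEntropy (sampleLaw μ k θ N) (fun ω => ξ ω.1) Prod.snd := by
  have hcard : 0 < (F.card : ℝ) := by exact_mod_cast hF.card_pos
  have hle := hk.entropy_joinTranslates_le hξ hθ F N
  simp only [meanEntropy, one_div]
  rw [inv_mul_le_iff₀ hcard]
  refine hle.trans_eq ?_
  field_simp

lemma partitionPEntropy_le [IsProbabilityMeasure μ] [MeasurableConstSMul G X]
    [SMulInvariantMeasure G X μ] [MeasurableConstSMul G Y] (hk : IsMarkovFamily G μ ν k)
    {P : ℕ → Finset G} (hP : ∀ j, (P j).Nonempty)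
    {r s : ℕ} {ξ : X → Fin r} (hξ : Measurable ξ) {θ : Y → Fin s} (hθ : Measurable θ)
    (hθ0 : partitionPEntropy ν P θ ≤ 0) (N : ℕ) :
    partitionPEntropy μ P ξ ≤
      (condEntropy (sampleLaw μ k θ N) (fun ω => ξ ω.1) Prod.snd : ℝ) := by
  set b := condEntropy (sampleLaw μ k θ N) (fun ω => ξ ω.1) Prod.snd
  refine EReal.le_of_forall_lt_iff_le.1 fun a ha => ?_
  have hδ : 0 < (a - b) / (N + 1) := div_pos (sub_pos.2 (EReal.coe_lt_coe_iff.1 ha)) (by positivity)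
  have hsmall : ∀ᶠ j in atTop, ((meanEntropy ν (P j) θ : ℝ) : EReal) < ((a - b) / (N + 1) : ℝ) :=
    eventually_lt_of_limsup_lt (hθ0.trans_lt (by exact_mod_cast hδ))
  refine limsup_le_of_le (h := hsmall.mono fun j hj => EReal.coe_le_coe_iff.2 ?_)
  have hj : meanEntropy ν (P j) θ ≤ (a - b) / (N + 1) := (EReal.coe_lt_coe_iff.1 hj).le
  calc meanEntropy μ (P j) ξ
      ≤ N * meanEntropy ν (P j) θ + b := hk.meanEntropy_le hξ hθ (hP j) N
    _ ≤ N * ((a - b) / (N + 1)) + b := by gcongr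
    _ ≤ (N + 1) * ((a - b) / (N + 1)) + b := by gcongr; linarith
    _ = a := by field_simp; ring

end IsMarkovFamily

end Sampling

section LawOfLargeNumbers

lemma sum_prod_mul_sum_sq {κ : Type*} [Fintype κ] {w v : κ → ℝ} (hw : ∑ a, w a = 1)
    (hwv : ∑ a, w a * v a = 0) (N : ℕ) :
    ∑ c : Fin N → κ, (∏ m, w (c m)) * (∑ m, v (c m)) ^ 2 = N * ∑ a, w a * v a ^ 2 := by
  induction N with
  | zero => simp
  | succ N ih =>
    have total : ∑ c : Fin N → κ, ∏ m, w (c m) = 1 := by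
      simpa [hw] using (Fintype.sum_pow w N).symm
    have expand (a : κ) (c : Fin N → κ) :
        w a * (∏ m, w (c m)) * (v a + ∑ m, v (c m)) ^ 2 =
          (w a * v a ^ 2) * (∏ m, w (c m)) +
            (w a * v a) * (2 * ((∏ m, w (c m)) * ∑ m, v (c m))) +
            w a * ((∏ m, w (c m)) * (∑ m, v (c m)) ^ 2) := by ring
    rw [← (Fin.consEquiv fun _ => κ).sum_comp, Fintype.sum_prod_type]
    simp only [Fin.consEquiv_apply, Fin.prod_univ_succ, Fin.sum_univ_succ, Fin.cons_zero,
      Fin.cons_succ, expand, Finset.sum_add_distrib, ← Finset.mul_sum, ← Finset.sum_mul, hw, hwv,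
      total, ih]
    push_cast
    ring

/-- The relative frequency of the label `b` in the sample `c`. For an empty sample it is the junk
value `0 / 0 = 0`. -/
def labelFrequency {κ : Type*} [DecidableEq κ] {N : ℕ} (b : κ) (c : Fin N → κ) : ℝ :=
  (∑ m, if c m = b then 1 else 0) / N

lemma sum_prod_mul_sq_labelFrequency_sub_le {κ : Type*} [Fintype κ] [DecidableEq κ] {w : κ → ℝ}
    (hw0 : ∀ a, 0 ≤ w a) (hw1 : ∑ a, w a = 1) {N : ℕ} (hN : 0 < N) (b : κ) :
    ∑ c : Fin N → κ, (∏ m, w (c m)) * (labelFrequency b c - w b) ^ 2 ≤ 1 / N := by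
  have hN0 : (0 : ℝ) < N := by exact_mod_cast hN
  have hb : w b ≤ 1 := hw1 ▸ Finset.single_le_sum (fun a _ => hw0 a) (Finset.mem_univ b)
  set v : κ → ℝ := fun a => (if a = b then 1 else 0) - w b with hv
  have centred : ∑ a, w a * v a = 0 := by
    simp [hv, mul_sub, Finset.sum_sub_distrib, ← Finset.sum_mul, hw1]
  have bounded : ∑ a, w a * v a ^ 2 ≤ 1 := by
    rw [← hw1]
    refine Finset.sum_le_sum fun a _ => mul_le_of_le_one_right (hw0 a) ?_
    have := hw0 b
    simp only [hv]
    split_ifs <;> nlinarith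
  have deviation (c : Fin N → κ) : labelFrequency b c - w b = (∑ m, v (c m)) / N := by
    simp only [labelFrequency, hv, Finset.sum_sub_distrib, Finset.sum_const, Finset.card_univ,
      Fintype.card_fin, nsmul_eq_mul]
    field_simp
  simp only [deviation, div_pow, ← mul_div_assoc]
  rw [← Finset.sum_div, sum_prod_mul_sum_sq hw1 centred, div_le_div_iff₀ (by positivity) hN0]
  nlinarith

variable {G X Y κ : Type*} [Group G] [MulAction G X] [MeasurableSpace X]
  [MulAction G Y] [MeasurableSpace Y] {μ : Measure X} {ν : Measure Y} {k : Set Y → X → ℝ}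
  [DecidableEq κ] [MeasurableSpace κ] [MeasurableSingletonClass κ]

namespace IsMarkovFamily

lemma measurable_sq_labelFrequency_sub [Finite κ] (hk : IsMarkovFamily G μ ν k) {θ : Y → κ}
    (hθ : Measurable θ) {N : ℕ} (b : κ) : Measurable fun ω : X × (Fin N → κ) =>
      ENNReal.ofReal ((labelFrequency b ω.2 - k (θ ⁻¹' {b}) ω.1) ^ 2) :=
  ENNReal.measurable_ofReal.comp ((Measurable.fun_sub
    ((measurable_of_finite fun c : Fin N → κ => labelFrequency b c).comp measurable_snd)
    ((hk.measurable _ (hθ (measurableSet_singleton b))).comp measurable_fst)).pow_const 2)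

variable [Fintype κ]

lemma lintegral_sq_labelFrequency_sub_le [IsProbabilityMeasure μ] (hk : IsMarkovFamily G μ ν k)
    {θ : Y → κ} (hθ : Measurable θ) {N : ℕ} (hN : 0 < N) (b : κ) :
    ∫⁻ ω, ENNReal.ofReal ((labelFrequency b ω.2 - k (θ ⁻¹' {b}) ω.1) ^ 2) ∂(sampleLaw μ k θ N) ≤
      ENNReal.ofReal (1 / N) := by
  rw [hk.lintegral_sampleLaw hθ (hk.measurable_sq_labelFrequency_sub hθ b)]
  refine (lintegral_mono_ae (g := fun _ => ENNReal.ofReal (1 / N)) ?_).trans (by simp)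
  filter_upwards [hk.nonneg_preimage hθ, hk.sum_preimage_univ hθ] with x hnonneg hsum
  have hweight (c : Fin N → κ) : 0 ≤ ∏ m, k (θ ⁻¹' {c m}) x :=
    Finset.prod_nonneg fun m _ => hnonneg _
  simp only [← ENNReal.ofReal_mul (hweight _)]
  rw [← ENNReal.ofReal_sum_of_nonneg fun c _ => mul_nonneg (hweight c) (sq_nonneg _)]
  exact ENNReal.ofReal_le_ofReal (sum_prod_mul_sq_labelFrequency_sub_le hnonneg hsum hN b)

lemma sampleLaw_deviation_le [IsProbabilityMeasure μ] (hk : IsMarkovFamily G μ ν k)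
    {θ : Y → κ} (hθ : Measurable θ) {N : ℕ} (hN : 0 < N) (b : κ) {δ : ℝ} (hδ : 0 < δ) :
    sampleLaw μ k θ N {ω | δ ≤ |labelFrequency b ω.2 - k (θ ⁻¹' {b}) ω.1|} ≤
      ENNReal.ofReal (1 / (N * δ ^ 2)) := by
  have chebyshev := meas_ge_le_lintegral_div (μ := sampleLaw μ k θ N) (ε := ENNReal.ofReal (δ ^ 2))
    (hk.measurable_sq_labelFrequency_sub hθ b).aemeasurable (by positivity) ENNReal.ofReal_ne_top
  have hset : {ω : X × (Fin N → κ) | δ ≤ |labelFrequency b ω.2 - k (θ ⁻¹' {b}) ω.1|} ⊆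
      {ω | ENNReal.ofReal (δ ^ 2) ≤
        ENNReal.ofReal ((labelFrequency b ω.2 - k (θ ⁻¹' {b}) ω.1) ^ 2)} := fun ω hω => by
    rw [Set.mem_ofPred_eq, ← sq_abs (labelFrequency b ω.2 - _)]
    exact ENNReal.ofReal_le_ofReal (pow_le_pow_left₀ hδ.le hω 2)
  rw [← div_div, ENNReal.ofReal_div_of_pos (by positivity)]
  exact (measure_mono hset).trans (chebyshev.trans
    (ENNReal.div_le_div_right (hk.lintegral_sq_labelFrequency_sub_le hθ hN b) _))

end IsMarkovFamily

end LawOfLargeNumbers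

section PredictableSets

/-- The set `A` is recovered from the second coordinate, up to an event of `ρ`-measure at most
`ε`. -/
def IsEstimable {X β : Type*} [MeasurableSpace X] [MeasurableSpace β] (ρ : Measure (X × β))
    (ε : ℝ≥0∞) (A : Set X) : Prop :=
  ∃ D : Set β, ρ ((Prod.fst ⁻¹' A) ∆ (Prod.snd ⁻¹' D)) ≤ ε

namespace IsEstimable

variable {X β γ : Type*} [MeasurableSpace X] [MeasurableSpace β] [MeasurableSpace γ]
  {ρ : Measure (X × β)} {ε ε' : ℝ≥0∞} {A A' : Set X}

lemma compl (h : IsEstimable ρ ε A) : IsEstimable ρ ε Aᶜ := by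
  obtain ⟨D, hD⟩ := h
  exact ⟨Dᶜ, by rwa [preimage_compl, preimage_compl, compl_symmDiff_compl]⟩

lemma union (h : IsEstimable ρ ε A) (h' : IsEstimable ρ ε' A') :
    IsEstimable ρ (ε + ε') (A ∪ A') := by
  obtain ⟨D, hD⟩ := h
  obtain ⟨D', hD'⟩ := h'
  refine ⟨D ∪ D', (measure_mono ?_).trans ((measure_union_le _ _).trans (add_le_add hD hD'))⟩
  rw [preimage_union, preimage_union]
  exact union_symmDiff_union_subset ..

lemma of_symmDiff (h : IsEstimable ρ ε A') (hA : ρ (Prod.fst ⁻¹' (A ∆ A')) ≤ ε') :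
    IsEstimable ρ (ε' + ε) A := by
  obtain ⟨D, hD⟩ := h
  exact ⟨D, (measure_symmDiff_le _ (Prod.fst ⁻¹' A') _).trans (add_le_add hA hD)⟩

lemma of_map {T : X → X} {φ : β → γ} (hT : Measurable T) (hφ : Measurable φ)
    (h : IsEstimable (ρ.map fun ω => (T ω.1, φ ω.2)) ε A) : IsEstimable ρ ε (T ⁻¹' A) := by
  obtain ⟨D, hD⟩ := h
  have hTφ : AEMeasurable (fun ω : X × β => (T ω.1, φ ω.2)) ρ := by fun_prop
  exact ⟨φ ⁻¹' D, (Measure.le_map_apply hTφ _).trans hD⟩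

end IsEstimable

variable {G X Y κ κ' : Type*} [Group G] [MulAction G X] [MeasurableSpace X]
  [MulAction G Y] [MeasurableSpace Y] {μ : Measure X} {ν : Measure Y} {k : Set Y → X → ℝ}

/-- The measurable set `A` can be recovered with arbitrarily small error from finitely many
independent samples of a finite partition of `Y`. -/
def IsPredictable (μ : Measure X) (k : Set Y → X → ℝ) (A : Set X) : Prop :=
  MeasurableSet A ∧ ∀ ε, 0 < ε → ∃ (N r : ℕ) (θ : Y → Fin r), Measurable θ ∧
    IsEstimable (sampleLaw μ k θ N) ε A

namespace IsMarkovFamily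

variable [MeasurableConstSMul G X] [SMulInvariantMeasure G X μ]

lemma isEstimable_preimage_smul [Fintype κ] [MeasurableSpace κ] [MeasurableSingletonClass κ]
    [Fintype κ'] [MeasurableSpace κ'] [MeasurableSingletonClass κ'] (hk : IsMarkovFamily G μ ν k)
    {θ : Y → κ} (hθ : Measurable θ) {η : Y → κ'} (hη : Measurable η) {g : G} {φ : κ → κ'}
    (hφ : ∀ y, φ (θ y) = η (g • y)) {N N' : ℕ} {e : Fin N → Fin N'} (he : Injective e)
    {ε : ℝ≥0∞} {A : Set X} (hA : IsEstimable (sampleLaw μ k η N) ε A) :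
    IsEstimable (sampleLaw μ k θ N') ε ((g • ·) ⁻¹' A) := by
  rw [← hk.map_sampleLaw hθ hη g hφ he] at hA
  exact hA.of_map (measurable_const_smul g) (measurable_of_finite fun c m => φ (c (e m)))

lemma exists_common_refinement (hk : IsMarkovFamily G μ ν k) {N₁ N₂ r₁ r₂ : ℕ} {θ₁ : Y → Fin r₁}
    (hθ₁ : Measurable θ₁) {θ₂ : Y → Fin r₂} (hθ₂ : Measurable θ₂) :
    ∃ (N r : ℕ) (θ : Y → Fin r), Measurable θ ∧ ∀ ε A,
      (IsEstimable (sampleLaw μ k θ₁ N₁) ε A → IsEstimable (sampleLaw μ k θ N) ε A) ∧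
      (IsEstimable (sampleLaw μ k θ₂ N₂) ε A → IsEstimable (sampleLaw μ k θ N) ε A) := by
  have hθ : Measurable fun y => finProdFinEquiv (θ₁ y, θ₂ y) :=
    (measurable_of_finite finProdFinEquiv).comp (hθ₁.prodMk hθ₂)
  refine ⟨N₁ + N₂, r₁ * r₂, _, hθ, fun ε A => ⟨fun h => ?_, fun h => ?_⟩⟩
  · simpa using hk.isEstimable_preimage_smul hθ hθ₁ (g := 1)
      (φ := fun i => (finProdFinEquiv.symm i).1) (by simp) (Fin.castAdd_injective N₁ N₂) h
  · simpa using hk.isEstimable_preimage_smul hθ hθ₂ (g := 1)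
      (φ := fun i => (finProdFinEquiv.symm i).2) (by simp) (Fin.natAdd_injective N₂ N₁) h

lemma exists_forall_isEstimable (hk : IsMarkovFamily G μ ν k) {ι : Type*} {A : ι → Set X}
    (hA : ∀ i, IsPredictable μ k (A i)) {ε : ℝ≥0∞} (hε : 0 < ε) (s : Finset ι) :
    ∃ (N r : ℕ) (θ : Y → Fin r), Measurable θ ∧
      ∀ i ∈ s, IsEstimable (sampleLaw μ k θ N) ε (A i) := by
  classical
  induction s using Finset.induction_on with
  | empty => exact ⟨0, 1, fun _ => 0, measurable_const, by simp⟩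
  | insert i s _ ih =>
    obtain ⟨N₁, r₁, θ₁, hθ₁, hi⟩ := (hA i).2 ε hε
    obtain ⟨N₂, r₂, θ₂, hθ₂, hs⟩ := ih
    obtain ⟨N, r, θ, hθ, href⟩ := hk.exists_common_refinement hθ₁ hθ₂
    refine ⟨N, r, θ, hθ, fun j hj => ?_⟩
    obtain rfl | hj := Finset.mem_insert.1 hj
    exacts [(href ε _).1 hi, (href ε _).2 (hs j hj)]

end IsMarkovFamily

namespace IsPredictable

variable {A A' : Set X}

lemma compl (hA : IsPredictable μ k A) : IsPredictable μ k Aᶜ := by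
  refine ⟨hA.1.compl, fun ε hε => ?_⟩
  obtain ⟨N, r, θ, hθ, hest⟩ := hA.2 ε hε
  exact ⟨N, r, θ, hθ, hest.compl⟩

lemma of_forall_symmDiff (hk : IsMarkovFamily G μ ν k) (hA : MeasurableSet A)
    (happrox : ∀ ε, 0 < ε → ∃ A', IsPredictable μ k A' ∧ μ (A ∆ A') ≤ ε) :
    IsPredictable μ k A := by
  refine ⟨hA, fun ε hε => ?_⟩
  obtain ⟨A', hA', hdiff⟩ := happrox (ε / 2) (ENNReal.half_pos hε.ne')
  obtain ⟨N, r, θ, hθ, hest⟩ := hA'.2 (ε / 2) (ENNReal.half_pos hε.ne')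
  refine ⟨N, r, θ, hθ, ENNReal.add_halves ε ▸ hest.of_symmDiff ?_⟩
  rwa [← Measure.map_apply measurable_fst (hA.symmDiff hA'.1), hk.map_fst_sampleLaw hθ]

variable [MeasurableConstSMul G X] [SMulInvariantMeasure G X μ]

lemma preimage_smul [MeasurableConstSMul G Y] (hk : IsMarkovFamily G μ ν k)
    (hA : IsPredictable μ k A) (g : G) : IsPredictable μ k ((g • ·) ⁻¹' A) := by
  refine ⟨measurable_const_smul g hA.1, fun ε hε => ?_⟩
  obtain ⟨N, r, θ, hθ, hest⟩ := hA.2 ε hε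
  have hgθ := hθ.comp (measurable_const_smul g)
  exact ⟨N, r, _, hgθ,
    hk.isEstimable_preimage_smul hgθ hθ (φ := id) (fun _ => rfl) injective_id hest⟩

lemma union (hk : IsMarkovFamily G μ ν k) (hA : IsPredictable μ k A)
    (hA' : IsPredictable μ k A') : IsPredictable μ k (A ∪ A') := by
  refine ⟨hA.1.union hA'.1, fun ε hε => ?_⟩
  obtain ⟨N₁, r₁, θ₁, hθ₁, hest⟩ := hA.2 (ε / 2) (ENNReal.half_pos hε.ne')
  obtain ⟨N₂, r₂, θ₂, hθ₂, hest'⟩ := hA'.2 (ε / 2) (ENNReal.half_pos hε.ne')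
  obtain ⟨N, r, θ, hθ, href⟩ := hk.exists_common_refinement hθ₁ hθ₂
  exact ⟨N, r, θ, hθ, ENNReal.add_halves ε ▸ ((href _ _).1 hest).union ((href _ _).2 hest')⟩

lemma iUnion [IsFiniteMeasure μ] (hk : IsMarkovFamily G μ ν k) {A : ℕ → Set X}
    (hA : ∀ i, IsPredictable μ k (A i)) : IsPredictable μ k (⋃ i, A i) := by
  have hacc (n : ℕ) : IsPredictable μ k (accumulate A n) := by
    induction n with
    | zero => simpa [accumulate] using hA 0
    | succ n ih => exact accumulate_succ A n ▸ ih.union hk (hA _)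
  have hmeas : MeasurableSet (⋃ i, A i) := .iUnion fun i => (hA i).1
  have hlim : Tendsto (fun n => μ ((⋃ i, A i) \ accumulate A n)) atTop (𝓝 0) := by
    have h := tendsto_measure_iInter_atTop (μ := μ) (s := fun n => (⋃ i, A i) \ accumulate A n)
      (fun n => (hmeas.diff (hacc n).1).nullMeasurableSet)
      (fun m n hmn => sdiff_subset_sdiff_right (monotone_accumulate hmn)) ⟨0, measure_ne_top _ _⟩
    rwa [← sdiff_iUnion, iUnion_accumulate, sdiff_self, measure_empty] at h
  refine of_forall_symmDiff hk hmeas fun ε hε => ?_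
  obtain ⟨n, hn⟩ := (ENNReal.tendsto_nhds_zero.1 hlim ε hε).exists
  refine ⟨accumulate A n, hacc n, ?_⟩
  rwa [symmDiff_of_ge (accumulate_subset_iUnion n)]

end IsPredictable

namespace IsMarkovFamily

variable [MeasurableConstSMul G X] [SMulInvariantMeasure G X μ]

/-- The σ-algebra of the sets of `X` predictable from samples of `Y`; it turns out to be a factor
of zero entropy when the action on `Y` has zero entropy. -/
@[reducible]
def predictableAlgebra [IsFiniteMeasure μ] (hk : IsMarkovFamily G μ ν k) : MeasurableSpace X where
  MeasurableSet' := IsPredictable μ k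
  measurableSet_empty := ⟨.empty, fun _ _ => ⟨0, 1, fun _ => 0, measurable_const, ∅, by simp⟩⟩
  measurableSet_compl _ hA := hA.compl
  measurableSet_iUnion _ hA := .iUnion hk hA

lemma predictableAlgebra_le [IsFiniteMeasure μ] (hk : IsMarkovFamily G μ ν k) :
    hk.predictableAlgebra ≤ ‹MeasurableSpace X› :=
  fun _ hA => hA.1

lemma isFactor_predictableAlgebra [IsFiniteMeasure μ] [MeasurableConstSMul G Y]
    (hk : IsMarkovFamily G μ ν k) : IsFactor G hk.predictableAlgebra where
  le := hk.predictableAlgebra_le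
  invariant g _ hA := hA.preimage_smul hk g

lemma exists_condEntropy_le [IsProbabilityMeasure μ] (hk : IsMarkovFamily G μ ν k) {r : ℕ}
    {ξ : X → Fin r} (hξ : Measurable[hk.predictableAlgebra] ξ) {δ : ℝ} (hδ : 0 < δ) :
    ∃ (N l : ℕ) (θ : Y → Fin l), Measurable θ ∧
      condEntropy (sampleLaw μ k θ N) (fun ω => ξ ω.1) Prod.snd ≤ δ := by
  set ε : ℝ := δ / (2 * (r + 1)) with hε
  set M : ℝ := max 1 (-Real.log ε)
  set γ : ℝ := δ / (2 * (r + 1) * M) with hγ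
  have hM0 : 0 < M := lt_max_of_lt_left one_pos
  obtain ⟨N, l, θ, hθ, hest⟩ := hk.exists_forall_isEstimable (A := fun i => ξ ⁻¹' {i})
    (fun i => hξ (measurableSet_singleton i)) (ENNReal.ofReal_pos.2 (by positivity : 0 < γ))
    Finset.univ
  refine ⟨N, l, θ, hθ, ?_⟩
  have := hk.isProbabilityMeasure_sampleLaw hθ N
  choose D hD using fun i => hest i (Finset.mem_univ i)
  have hξfst : Measurable fun ω : X × (Fin N → Fin l) => ξ ω.1 :=
    (hξ.mono hk.predictableAlgebra_le le_rfl).comp measurable_fst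
  have herror (i : Fin r) : (sampleLaw μ k θ N).real
      (((fun ω => ξ ω.1) ⁻¹' {i}) ∆ (Prod.snd ⁻¹' D i)) ≤ γ :=
    ENNReal.toReal_le_of_le_ofReal (by positivity) (hD i)
  calc condEntropy (sampleLaw μ k θ N) (fun ω => ξ ω.1) Prod.snd
      ≤ r * ε + M * ∑ i, (sampleLaw μ k θ N).real
          (((fun ω => ξ ω.1) ⁻¹' {i}) ∆ (Prod.snd ⁻¹' D i)) := by
        simpa using condEntropy_le_of_decision (ρ := sampleLaw μ k θ N) hξfst measurable_snd
          D (by positivity : 0 < ε)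
    _ ≤ r * ε + M * ∑ _i : Fin r, γ := by gcongr; exact herror _
    _ = r / (r + 1) * δ := by
        rw [Finset.sum_const, Finset.card_univ, Fintype.card_fin, nsmul_eq_mul, hγ, hε]
        field_simp
        ring
    _ ≤ δ := mul_le_of_le_one_left hδ.le (div_le_one_of_le₀ (by simp) (by positivity))

lemma factorPEntropy_predictableAlgebra_nonpos [MeasurableConstSMul G Y] [IsProbabilityMeasure μ]
    (hk : IsMarkovFamily G μ ν k) {P : ℕ → Finset G}
    (hP : ∀ j, (P j).Nonempty) (hν : pEntropy ν P ≤ 0) :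
    factorPEntropy hk.predictableAlgebra μ P ≤ 0 := by
  refine iSup_le fun r => iSup₂_le fun ξ hξ => EReal.le_of_forall_lt_iff_le.1 fun δ hδ => ?_
  obtain ⟨N, l, θ, hθ, hcond⟩ := hk.exists_condEntropy_le hξ (EReal.coe_pos.1 hδ)
  have hθ0 : partitionPEntropy ν P θ ≤ 0 :=
    (le_iSup₂_of_le l θ (le_iSup (fun _ => partitionPEntropy ν P θ) hθ)).trans hν
  exact (hk.partitionPEntropy_le hP (hξ.mono hk.predictableAlgebra_le le_rfl) hθ hθ0
    N).trans (EReal.coe_le_coe_iff.2 hcond)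

end IsMarkovFamily

end PredictableSets

section LevelSets

lemma exists_measure_preimage_Ico_le {X : Type*} [MeasurableSpace X] {μ : Measure X}
    [IsFiniteMeasure μ] {u : X → ℝ} (hu : Measurable u) (a : ℝ) {ε : ℝ≥0∞} (hε : 0 < ε) :
    ∃ δ > 0, μ (u ⁻¹' Ico (a - δ) a) ≤ ε := by
  have hlim := tendsto_measure_iInter_atTop (μ := μ)
    (s := fun n : ℕ => u ⁻¹' Ico (a - 1 / (n + 1)) a)
    (fun n => (hu measurableSet_Ico).nullMeasurableSet)
    (fun m n hmn => preimage_mono (Ico_subset_Ico_left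
      (sub_le_sub_left (Nat.one_div_le_one_div hmn) a))) ⟨0, measure_ne_top _ _⟩
  have hempty : ⋂ n : ℕ, u ⁻¹' Ico (a - 1 / ((n : ℝ) + 1)) a = ∅ := by
    refine eq_empty_of_forall_notMem fun x hx => ?_
    rw [mem_iInter] at hx
    obtain ⟨n, hn⟩ := exists_nat_one_div_lt (sub_pos.2 (hx 0).2)
    linarith [(hx n).1]
  rw [hempty, measure_empty] at hlim
  obtain ⟨n, hn⟩ := (ENNReal.tendsto_nhds_zero.1 hlim ε hε).exists
  exact ⟨1 / (n + 1), Nat.one_div_pos_of_nat, hn⟩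

lemma exists_ofReal_one_div_mul_le {δ : ℝ} (hδ : 0 < δ) {ε : ℝ≥0∞} (hε : 0 < ε) :
    ∃ N : ℕ, 0 < N ∧ ENNReal.ofReal (1 / (N * δ)) ≤ ε := by
  have hlim : Tendsto (fun N : ℕ => ENNReal.ofReal (1 / (N * δ))) atTop (𝓝 0) := by
    rw [← ENNReal.ofReal_zero]
    exact ENNReal.tendsto_ofReal
      (tendsto_const_nhds.div_atTop (tendsto_natCast_atTop_atTop.atTop_mul_const hδ))
  obtain ⟨N, hN, hN0⟩ :=
    ((ENNReal.tendsto_nhds_zero.1 hlim ε hε).and (eventually_gt_atTop 0)).exists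
  exact ⟨N, hN0, hN⟩

lemma exists_ae_eq_const_of_not_isNontrivialAlgebra {X β : Type*} {𝓕 : MeasurableSpace X}
    [mX : MeasurableSpace X] {μ : Measure X} [IsProbabilityMeasure μ] [MeasurableSpace β]
    [MeasurableSpace.CountablySeparated β] [Nonempty β] (h𝓕 : 𝓕 ≤ mX)
    (htriv : ¬ IsNontrivialAlgebra 𝓕 μ) {f : X → β} (hf : Measurable[𝓕] f) :
    ∃ a, f =ᵐ[μ] fun _ => a := by
  refine exists_eventuallyEq_const_of_forall_separating MeasurableSet fun U hU => ?_
  have h01 : μ (f ⁻¹' U) = 0 ∨ μ (f ⁻¹' U) = 1 := by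
    by_contra! h
    exact htriv ⟨_, hf hU, h⟩
  rcases h01 with h0 | h1
  · exact .inr (measure_eq_zero_iff_ae_notMem.1 h0)
  · exact .inl ((mem_ae_iff_prob_eq_one (h𝓕 _ (hf hU))).2 h1)

variable {G X Y κ : Type*} [Group G] [MulAction G X] [MeasurableSpace X]
  [MulAction G Y] [MeasurableSpace Y] {μ : Measure X} {ν : Measure Y} {k : Set Y → X → ℝ}

namespace IsMarkovFamily

variable [IsProbabilityMeasure μ]

lemma isEstimable_setOf_lt [Fintype κ] [MeasurableSpace κ] [MeasurableSingletonClass κ]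
    (hk : IsMarkovFamily G μ ν k) {θ : Y → κ} (hθ : Measurable θ)
    {N : ℕ} (hN : 0 < N) (b : κ) (a : ℝ) {δ : ℝ} (hδ : 0 < δ) :
    IsEstimable (sampleLaw μ k θ N)
      (μ (k (θ ⁻¹' {b}) ⁻¹' Ico (a - δ) a) + ENNReal.ofReal (1 / (N * (δ / 2) ^ 2)))
      {x | k (θ ⁻¹' {b}) x < a} := by
  classical
  refine ⟨{c | labelFrequency b c < a - δ / 2}, ?_⟩
  have hsubset : (Prod.fst ⁻¹' {x | k (θ ⁻¹' {b}) x < a}) ∆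
      (Prod.snd ⁻¹' {c : Fin N → κ | labelFrequency b c < a - δ / 2}) ⊆
      Prod.fst ⁻¹' (k (θ ⁻¹' {b}) ⁻¹' Ico (a - δ) a) ∪
        {ω | δ / 2 ≤ |labelFrequency b ω.2 - k (θ ⁻¹' {b}) ω.1|} := by
    rintro ω (⟨hlt, hge⟩ | ⟨hlt, hge⟩) <;>
      simp only [mem_preimage, Set.mem_ofPred_eq, not_lt, mem_union, mem_Ico, le_abs] at hlt hge ⊢
    · by_cases hgap : a - δ ≤ k (θ ⁻¹' {b}) ω.1
      · exact .inl ⟨hgap, hlt⟩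
      · exact .inr (.inl (by linarith))
    · exact .inr (.inr (by linarith))
  refine (measure_mono hsubset).trans ((measure_union_le _ _).trans (add_le_add (le_of_eq ?_)
    (hk.sampleLaw_deviation_le hθ hN b (half_pos hδ))))
  rw [← Measure.map_apply measurable_fst
    (hk.measurable _ (hθ (measurableSet_singleton b)) measurableSet_Ico), hk.map_fst_sampleLaw hθ]

lemma isPredictable_setOf_lt (hk : IsMarkovFamily G μ ν k) {B : Set Y} (hB : MeasurableSet B)
    (a : ℝ) : IsPredictable μ k {x | k B x < a} := by
  classical
  refine ⟨measurableSet_lt (hk.measurable B hB) measurable_const, fun ε hε => ?_⟩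
  set θ : Y → Fin 2 := fun y => if y ∈ B then 1 else 0
  have hθ : Measurable θ := .ite hB measurable_const measurable_const
  have hθB : θ ⁻¹' {1} = B := by ext y; simp [θ]
  obtain ⟨δ, hδ, hgap⟩ :=
    exists_measure_preimage_Ico_le (hk.measurable B hB) (μ := μ) a (ENNReal.half_pos hε.ne')
  obtain ⟨N, hN, hsmall⟩ := exists_ofReal_one_div_mul_le (by positivity : 0 < (δ / 2) ^ 2)
    (ENNReal.half_pos hε.ne')
  obtain ⟨D, hD⟩ := hk.isEstimable_setOf_lt hθ hN 1 a hδ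
  rw [hθB] at hD
  exact ⟨N, 2, θ, hθ, D,
    hD.trans ((add_le_add hgap hsmall).trans (ENNReal.add_halves ε).le)⟩

variable [MeasurableConstSMul G X] [SMulInvariantMeasure G X μ]

lemma measurable_predictableAlgebra (hk : IsMarkovFamily G μ ν k) {B : Set Y}
    (hB : MeasurableSet B) : Measurable[hk.predictableAlgebra] (k B) :=
  measurable_of_Iio fun a => hk.isPredictable_setOf_lt hB a

theorem ae_eq_const [MeasurableConstSMul G Y]
    (hk : IsMarkovFamily G μ ν k) {P : ℕ → Finset G} (hP : ∀ j, (P j).Nonempty)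
    (hμ : HasCompletelyPositivePEntropy μ P) (hν : pEntropy ν P ≤ 0) {B : Set Y}
    (hB : MeasurableSet B) : ∀ᵐ x ∂μ, k B x = ν.real B := by
  have htriv : ¬ IsNontrivialAlgebra hk.predictableAlgebra μ := fun hnontrivial =>
    (hμ _ hk.isFactor_predictableAlgebra hnontrivial).not_ge
      (hk.factorPEntropy_predictableAlgebra_nonpos hP hν)
  obtain ⟨a, ha⟩ := exists_ae_eq_const_of_not_isNontrivialAlgebra (μ := μ) hk.predictableAlgebra_le
    htriv (hk.measurable_predictableAlgebra hB)
  filter_upwards [ha] with x hx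
  rw [hx, ← hk.integral B hB, integral_congr_ae ha]
  simp

end IsMarkovFamily

end LevelSets

section Operators

open ContinuousLinearMap (adjoint adjoint_inner_left adjoint_inner_right)

variable {G X Y Z W : Type*} [Group G]
  [MulAction G X] [MeasurableSpace X] [MeasurableConstSMul G X]
  [MulAction G Y] [MeasurableSpace Y] [MeasurableConstSMul G Y]
  [MulAction G Z] [MeasurableSpace Z] [MeasurableConstSMul G Z]
  {μ : Measure X} [SMulInvariantMeasure G X μ]
  {ν : Measure Y} [SMulInvariantMeasure G Y ν]
  {lam : Measure Z} [SMulInvariantMeasure G Z lam]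

lemma inner_nonneg_of_nonneg {f g : Lp ℝ 2 μ} (hf : 0 ≤ f) (hg : 0 ≤ g) : 0 ≤ inner ℝ f g := by
  rw [L2.inner_def]
  refine integral_nonneg_of_ae ?_
  filter_upwards [(Lp.coeFn_nonneg f).2 hf, (Lp.coeFn_nonneg g).2 hg] with x hfx hgx
  simpa using mul_nonneg hgx hfx

lemma inner_koopman_koopman (g : G) (f h : Lp ℝ 2 μ) :
    inner ℝ (koopman μ g f) (koopman μ g h) = inner ℝ f h :=
  (Lp.compMeasurePreservingₗᵢ ℝ (g • ·) (measurePreserving_smul g μ)).inner_map_map f h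

lemma koopman_koopman_inv (g : G) (f : Lp ℝ 2 μ) : koopman μ g (koopman μ g⁻¹ f) = f := by
  rw [koopman, koopman, ← Lp.compMeasurePreserving_comp_apply]
  refine Lp.ext ?_
  filter_upwards [Lp.coeFn_compMeasurePreserving f ((measurePreserving_smul g⁻¹ μ).comp
    (measurePreserving_smul g μ))] with x hx
  rw [hx]
  simp

/-- The lift of functions along a factor map, as an operator on `L²`. -/
def factorLift (π : Z → X) (hπ : MeasurePreserving π lam μ) :
    Lp ℝ 2 μ →L[ℝ] Lp ℝ 2 lam :=
  (Lp.compMeasurePreservingₗᵢ ℝ π hπ).toContinuousLinearMap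

lemma coeFn_factorLift {π : Z → X} (hπ : MeasurePreserving π lam μ) (f : Lp ℝ 2 μ) :
    factorLift π hπ f =ᵐ[lam] f ∘ π :=
  Lp.coeFn_compMeasurePreserving f hπ

lemma integral_factorLift {π : Z → X} (hπ : MeasurePreserving π lam μ) (f : Lp ℝ 2 μ) :
    ∫ z, factorLift π hπ f z ∂lam = ∫ x, f x ∂μ := by
  have hf : AEStronglyMeasurable f (lam.map π) :=
    hπ.map_eq.symm ▸ (Lp.stronglyMeasurable f).aestronglyMeasurable
  have hmap := integral_map hπ.aemeasurable hf
  rw [hπ.map_eq] at hmap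
  rw [integral_congr_ae (coeFn_factorLift hπ f), hmap]
  rfl

lemma factorLift_koopman {π : Z → X} (hπ : MeasurePreserving π lam μ) {g : G}
    (hg : ∀ᵐ z ∂lam, π (g • z) = g • π z) (f : Lp ℝ 2 μ) :
    factorLift π hπ (koopman μ g f) = koopman lam g (factorLift π hπ f) := by
  have hgX := measurePreserving_smul g μ
  have hgZ := measurePreserving_smul g lam
  refine Lp.ext ?_
  filter_upwards [coeFn_factorLift hπ (koopman μ g f), hg,
    hπ.quasiMeasurePreserving.ae (Lp.coeFn_compMeasurePreserving f hgX),
    Lp.coeFn_compMeasurePreserving (factorLift π hπ f) hgZ,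
    hgZ.quasiMeasurePreserving.ae (coeFn_factorLift hπ f)] with z hlift hequiv hX hZ hlift_smul
  simp only [koopman, Function.comp_apply] at hlift hX hZ hlift_smul ⊢
  rw [hlift, hX, hZ, hlift_smul, hequiv]

section Indicators

variable [IsFiniteMeasure μ]

/-- The indicator of a measurable set in `L²`. -/
abbrev indicatorL2 (μ : Measure X) [IsFiniteMeasure μ] {s : Set X}
    (hs : MeasurableSet s) : Lp ℝ 2 μ :=
  indicatorConstLp 2 hs (measure_ne_top μ s) 1

lemma integral_indicatorL2 {s : Set X} (hs : MeasurableSet s) :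
    ∫ x, indicatorL2 μ hs x ∂μ = μ.real s := by
  rw [← setIntegral_univ, setIntegral_indicatorConstLp .univ]
  simp

lemma inner_const_left (c : ℝ) (f : Lp ℝ 2 μ) :
    inner ℝ (Lp.const 2 μ c) f = c * ∫ x, f x ∂μ := by
  rw [← indicatorConstLp_univ, L2.inner_indicatorConstLp_eq_inner_setIntegral, setIntegral_univ]
  simp [mul_comm]

lemma ext_inner_indicatorL2 {f g : Lp ℝ 2 μ}
    (h : ∀ (s : Set X) (hs : MeasurableSet s),
      inner ℝ (indicatorL2 μ hs) f = inner ℝ (indicatorL2 μ hs) g) : f = g := by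
  refine Lp.ext (Lp.ae_eq_of_forall_setIntegral_eq f g two_ne_zero ENNReal.ofNat_ne_top
    (fun s _ hs => integrableOn_Lp_of_measure_ne_top f fact_one_le_two_ennreal.elim hs.ne)
    (fun s _ hs => integrableOn_Lp_of_measure_ne_top g fact_one_le_two_ennreal.elim hs.ne)
    fun s hs _ => ?_)
  simpa only [L2.inner_indicatorConstLp_one] using h s hs

lemma nonneg_of_inner_indicatorL2 {f : Lp ℝ 2 μ}
    (h : ∀ (s : Set X) (hs : MeasurableSet s), 0 ≤ inner ℝ (indicatorL2 μ hs) f) : 0 ≤ f := by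
  refine (Lp.coeFn_nonneg f).1 (ae_nonneg_of_forall_setIntegral_nonneg
    ((Lp.memLp f).integrable fact_one_le_two_ennreal.elim) fun s hs _ => ?_)
  simpa only [L2.inner_indicatorConstLp_one] using h s hs

lemma indicatorL2_nonneg {s : Set X} (hs : MeasurableSet s) : 0 ≤ indicatorL2 μ hs := by
  refine (Lp.coeFn_nonneg _).1 ?_
  filter_upwards [indicatorConstLp_coeFn (p := 2) (hs := hs) (hμs := measure_ne_top μ s)
    (c := (1 : ℝ))] with x hx
  rw [hx]
  exact Set.indicator_nonneg (fun _ _ => zero_le_one) x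

lemma koopman_indicatorL2 (g : G) {s : Set X} (hs : MeasurableSet s) :
    koopman μ g (indicatorL2 μ hs) = indicatorL2 μ (measurable_const_smul g hs) :=
  Lp.indicatorConstLp_compMeasurePreserving hs _ _ _

/-- A representative of the image `J 1_s` of the indicator of `s` under an operator `J` on `L²`,
with the junk value `0` when `s` is not measurable. -/
def indicatorImage (J : Lp ℝ 2 μ →L[ℝ] Lp ℝ 2 ν) (s : Set X) : Y → ℝ :=
  open Classical in if hs : MeasurableSet s then J (indicatorL2 μ hs) else 0

lemma indicatorImage_of_measurableSet (J : Lp ℝ 2 μ →L[ℝ] Lp ℝ 2 ν) {s : Set X}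
    (hs : MeasurableSet s) : indicatorImage J s = J (indicatorL2 μ hs) :=
  dif_pos hs

end Indicators

variable [IsProbabilityMeasure μ] [IsProbabilityMeasure ν] [IsProbabilityMeasure lam]

namespace IsMarkovIntertwining

variable {J : Lp ℝ 2 μ →L[ℝ] Lp ℝ 2 ν}

protected lemma adjoint (h : IsMarkovIntertwining G μ ν J) :
    IsMarkovIntertwining G ν μ (adjoint J) where
  nonneg f hf := nonneg_of_inner_indicatorL2 fun s hs => by
    rw [adjoint_inner_right]
    exact inner_nonneg_of_nonneg (h.nonneg _ (indicatorL2_nonneg hs)) hf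
  map_one := h.adjoint_one
  adjoint_one := by rw [ContinuousLinearMap.adjoint_adjoint]; exact h.map_one
  intertwines g f := by
    refine ext_inner_left ℝ fun v => ?_
    rw [adjoint_inner_right, ← koopman_koopman_inv g v, h.intertwines, inner_koopman_koopman,
      inner_koopman_koopman, adjoint_inner_right]

protected lemma comp (h : IsMarkovIntertwining G μ ν J) {K : Lp ℝ 2 ν →L[ℝ] Lp ℝ 2 lam}
    (hK : IsMarkovIntertwining G ν lam K) : IsMarkovIntertwining G μ lam (K ∘L J) where
  nonneg f hf := hK.nonneg _ (h.nonneg f hf)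
  map_one := by rw [ContinuousLinearMap.comp_apply, h.map_one, hK.map_one]
  adjoint_one := by
    rw [ContinuousLinearMap.adjoint_comp, ContinuousLinearMap.comp_apply, hK.adjoint_one,
      h.adjoint_one]
  intertwines g f := by
    rw [ContinuousLinearMap.comp_apply, h.intertwines, hK.intertwines,
      ContinuousLinearMap.comp_apply]

lemma map_indicatorL2_ae (h : IsMarkovIntertwining G μ ν J) (g : G) {s : Set X}
    (hs : MeasurableSet s) :
    ∀ᵐ y ∂ν, J (indicatorL2 μ (measurable_const_smul g hs)) y = J (indicatorL2 μ hs) (g • y) := by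
  rw [← koopman_indicatorL2, h.intertwines]
  exact Lp.coeFn_compMeasurePreserving _ _

lemma isMarkovFamily (h : IsMarkovIntertwining G μ ν J) :
    IsMarkovFamily G ν μ (indicatorImage J) where
  measurable B hB := by
    rw [indicatorImage_of_measurableSet J hB]
    exact (Lp.stronglyMeasurable _).measurable
  nonneg B hB := by
    rw [indicatorImage_of_measurableSet J hB]
    exact (Lp.coeFn_nonneg _).2 (h.nonneg _ (indicatorL2_nonneg hB))
  union B C hB hC hBC := by
    rw [indicatorImage_of_measurableSet J hB, indicatorImage_of_measurableSet J hC,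
      indicatorImage_of_measurableSet J (hB.union hC), indicatorL2,
      indicatorConstLp_disjoint_union hB hC (measure_ne_top μ B) (measure_ne_top μ C) hBC, map_add]
    exact Lp.coeFn_add _ _
  univ := by
    rw [indicatorImage_of_measurableSet J .univ, indicatorL2, indicatorConstLp_univ, h.map_one]
    exact Lp.coeFn_const ..
  integral B hB := by
    rw [indicatorImage_of_measurableSet J hB, ← one_mul (∫ y, _ ∂ν), ← inner_const_left,
      ← adjoint_inner_left, h.adjoint_one, inner_const_left, one_mul, integral_indicatorL2]
  smul g B hB := by
    rw [indicatorImage_of_measurableSet J hB,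
      indicatorImage_of_measurableSet J (measurable_const_smul g hB)]
    exact h.map_indicatorL2_ae g hB

end IsMarkovIntertwining

lemma factorLift_indicatorL2 {π : Z → X} (hπ : MeasurePreserving π lam μ) {s : Set X}
    (hs : MeasurableSet s) :
    factorLift π hπ (indicatorL2 μ hs) = indicatorL2 lam (hπ.measurable hs) :=
  Lp.indicatorConstLp_compMeasurePreserving hs _ _ hπ

lemma isMarkovIntertwining_factorLift {π : Z → X} (hπ : MeasurePreserving π lam μ)
    (hπG : ∀ g : G, ∀ᵐ z ∂lam, π (g • z) = g • π z) :
    IsMarkovIntertwining G μ lam (factorLift π hπ) where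
  nonneg f hf := by
    refine (Lp.coeFn_nonneg _).1 ?_
    filter_upwards [coeFn_factorLift hπ f,
      hπ.quasiMeasurePreserving.ae ((Lp.coeFn_nonneg f).2 hf)] with z hlift hnonneg
    exact hlift ▸ hnonneg
  map_one := by
    rw [← indicatorConstLp_univ, ← indicatorConstLp_univ]
    exact factorLift_indicatorL2 hπ .univ
  adjoint_one := by
    refine ext_inner_right ℝ fun f => ?_
    rw [adjoint_inner_left, inner_const_left, inner_const_left, integral_factorLift]
  intertwines g f := factorLift_koopman hπ (hπG g) f

theorem areDisjoint_of_pEntropy {P : ℕ → Finset G} (hP : ∀ j, (P j).Nonempty)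
    (hμ : HasCompletelyPositivePEntropy μ P) (hν : pEntropy ν P ≤ 0) : AreDisjoint G μ ν := by
  intro J hJ f
  refine ext_inner_indicatorL2 fun B hB => ?_
  have himage : adjoint J (indicatorL2 ν hB) = Lp.const 2 μ (ν.real B) := by
    refine Lp.ext ?_
    filter_upwards [hJ.adjoint.isMarkovFamily.ae_eq_const hP hμ hν hB,
      Lp.coeFn_const (p := 2) (μ := μ) (ν.real B)] with x hx hconst
    rw [← indicatorImage_of_measurableSet _ hB, hx, hconst]
    rfl
  rw [← adjoint_inner_left, himage, inner_const_left, real_inner_comm, inner_const_left,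
    integral_indicatorL2, mul_comm]

namespace AreDisjoint

lemma measure_preimage_inter_preimage (h : AreDisjoint G μ ν) {π : Z → Y} {σ : Z → X}
    (hπ : MeasurePreserving π lam ν) (hπG : ∀ g : G, ∀ᵐ z ∂lam, π (g • z) = g • π z)
    (hσ : MeasurePreserving σ lam μ) (hσG : ∀ g : G, ∀ᵐ z ∂lam, σ (g • z) = g • σ z)
    {A : Set Y} (hA : MeasurableSet A) {B : Set X} (hB : MeasurableSet B) :
    lam (π ⁻¹' A ∩ σ ⁻¹' B) = ν A * μ B := by
  have hjoining := h _ ((isMarkovIntertwining_factorLift hσ hσG).comp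
    (isMarkovIntertwining_factorLift hπ hπG).adjoint) (indicatorL2 μ hB)
  rw [← ENNReal.toReal_eq_toReal_iff' (measure_ne_top _ _)
    (ENNReal.mul_ne_top (measure_ne_top _ _) (measure_ne_top _ _)), ENNReal.toReal_mul]
  calc lam.real (π ⁻¹' A ∩ σ ⁻¹' B)
      = inner ℝ (factorLift π hπ (indicatorL2 ν hA)) (factorLift σ hσ (indicatorL2 μ hB)) := by
        rw [factorLift_indicatorL2, factorLift_indicatorL2,
          L2.real_inner_indicatorConstLp_one_indicatorConstLp_one]
    _ = inner ℝ (indicatorL2 ν hA) (Lp.const 2 ν (μ.real B)) := by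
        rw [← adjoint_inner_right, ← ContinuousLinearMap.comp_apply, hjoining,
          integral_indicatorL2]
    _ = ν.real A * μ.real B := by
        rw [real_inner_comm, inner_const_left, integral_indicatorL2, mul_comm]

theorem indep (h : AreDisjoint G μ ν) {𝓐 𝓑 : MeasurableSpace W} [MeasurableSpace W]
    [MulAction G W] [MeasurableConstSMul G W] {κ : Measure W} [IsProbabilityMeasure κ]
    [SMulInvariantMeasure G W κ]
    (h𝓐 : IsFactorIsomorphicTo G 𝓐 κ ν) (h𝓑 : IsFactorIsomorphicTo G 𝓑 κ μ) :
    ProbabilityTheory.Indep 𝓐 𝓑 κ := by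
  obtain ⟨-, π, hπ, hπG, hπ𝓐, -⟩ := h𝓐
  obtain ⟨-, σ, hσ, hσG, hσ𝓑, -⟩ := h𝓑
  rw [ProbabilityTheory.Indep_iff]
  intro s t hs ht
  obtain ⟨A, hA, hsA⟩ := hπ𝓐 s hs
  obtain ⟨B, hB, htB⟩ := hσ𝓑 t ht
  rw [measure_congr (hsA.inter htB), measure_congr hsA, measure_congr htB,
    h.measure_preimage_inter_preimage hπ hπG hσ hσG hA hB,
    hπ.measure_preimage hA.nullMeasurableSet, hσ.measure_preimage hB.nullMeasurableSet]

end AreDisjoint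

end Operators

end PEntropy

end

theorem mainTheorem3_general {G : Type*} [Group G] (P : ℕ → Finset G) (hP : ∀ j, (P j).Nonempty)
    {X : Type*} [MeasurableSpace X] (μ : Measure X) [IsProbabilityMeasure μ]
    [MulAction G X] [MeasurableConstSMul G X] [SMulInvariantMeasure G X μ]
    {Y : Type*} [MeasurableSpace Y] (ν : Measure Y) [IsProbabilityMeasure ν]
    [MulAction G Y] [MeasurableConstSMul G Y] [SMulInvariantMeasure G Y ν]
    (hT : PEntropy.HasCompletelyPositivePEntropy μ P) (hS : PEntropy.pEntropy ν P = 0) :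
    PEntropy.AreDisjoint G μ ν ∧
    ∀ {Z : Type*} (𝓐 𝓑 : MeasurableSpace Z) [MeasurableSpace Z]
      (lam : Measure Z) [IsProbabilityMeasure lam]
      [MulAction G Z] [MeasurableConstSMul G Z] [SMulInvariantMeasure G Z lam],
      PEntropy.IsFactorIsomorphicTo G 𝓐 lam ν → PEntropy.IsFactorIsomorphicTo G 𝓑 lam μ →
      ProbabilityTheory.Indep 𝓐 𝓑 lam := by
  have hdisjoint := PEntropy.areDisjoint_of_pEntropy hP hT hS.le
  exact ⟨hdisjoint, fun _ _ _ _ _ _ _ _ h𝓐 h𝓑 => hdisjoint.indep h𝓐 h𝓑⟩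

theorem mainTheorem3 {G : Type*} [Group G] [Countable G] [Infinite G]
    (P : ℕ → Finset G) (hP : ∀ j, (P j).Nonempty)
    -- the action `T` of `G` on the standard probability space `(X, μ)`
    {X : Type*} [MeasurableSpace X] [StandardBorelSpace X] (μ : Measure X) [IsProbabilityMeasure μ]
    [MulAction G X] [MeasurableConstSMul G X] [SMulInvariantMeasure G X μ]
    -- the action `S` of `G` on the standard probability space `(Y, ν)`
    {Y : Type*} [MeasurableSpace Y] [StandardBorelSpace Y] (ν : Measure Y) [IsProbabilityMeasure ν]
    [MulAction G Y] [MeasurableConstSMul G Y] [SMulInvariantMeasure G Y ν]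
    (hT : PEntropy.HasCompletelyPositivePEntropy μ P)
    (hS : PEntropy.pEntropy ν P = 0) :
    PEntropy.AreDisjoint G μ ν ∧
    ∀ {Z : Type*} (𝓐 𝓑 : MeasurableSpace Z) [MeasurableSpace Z] [StandardBorelSpace Z]
      (lam : Measure Z) [IsProbabilityMeasure lam]
      [MulAction G Z] [MeasurableConstSMul G Z] [SMulInvariantMeasure G Z lam],
      PEntropy.IsFactorIsomorphicTo G 𝓐 lam ν → PEntropy.IsFactorIsomorphicTo G 𝓑 lam μ →
      ProbabilityTheory.Indep 𝓐 𝓑 lam := by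
  obtain ⟨hdisjoint, hindep⟩ := mainTheorem3_general P hP μ ν hT hS
  exact ⟨hdisjoint, fun 𝓐 𝓑 _ _ lam _ _ _ _ => hindep 𝓐 𝓑 lam⟩
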